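/- Let $d\ge 2$ be an integer and let $1<q<d$. There is a constant $N=N(d,q)>0$, depending only on $d$ and $q$, such that the following holds. Let $0\le\gamma\le 1/48$, $R_0>0$, and let $\Omega\subset\mathbb{R}^d$ be a domain (a nonempty connected open set, not necessarily bounded) which is Reifenberg flat in the following sense: for every $x_0\in\partial\Omega$ and every $0<R\le R_0$ there is a Cartesian coordinate system (obtained by a rigid motion, depending on $x_0$ and $R$), in which, writing $y_1$ and $x_{01}$ for the first coordinates of $y$ and $x_0$, $$ \{y: x_{01}+\gamma R<y_1\}\cap B_R(x_0)\subset \Omega\cap B_R(x_0)\subset \{y: x_{01}-\gamma R<y_1\}\cap B_R(x_0). $$ Write $\Omega_r(x)=\Omega\cap B_r(x)$, where $B_r(x)$ is the open Euclidean ball, and $(u)_{A}=\frac{1}{|A|}\int_A u\,dx$. Then for every $x_0\in\partial\Omega$, every $0<R\le R_0/4$ and every real-valued $u$ in the Sobolev space $W^1_q(\Omega)$ (that is, $u\in L_q(\Omega)$ with weak gradient $Du\in L_q(\Omega)$), $$ \|u-(u)_{\Omega_R(x_0)}\|_{L_{dq/(d-q)}(\Omega_R(x_0))}\le N\,\|Du\|_{L_q(\Omega_{2R}(x_0))}.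 $$ -/

import Mathlib

open MeasureTheory Set
open scoped ContDiff

namespace Reifenberg

/-- A test function on `Ω`: a real-valued smooth function with compact support inside `Ω`. -/
structure IsTestFunction {d : ℕ} (Ω : Set (EuclideanSpace ℝ (Fin d)))
    (φ : EuclideanSpace ℝ (Fin d) → ℝ) : Prop where
  smooth : ContDiff ℝ ∞ φ
  hasCompactSupport : HasCompactSupport φ
  tsupport_subset : tsupport φ ⊆ Ω

/-- `v` is the weak partial derivative `D_i u` of `u` on the open set `Ω`. -/
structure HasWeakPartialDeriv {d : ℕ} (Ω : Set (EuclideanSpace ℝ (Fin d))) (i : Fin d)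
    (u v : EuclideanSpace ℝ (Fin d) → ℝ) : Prop where
  locallyIntegrable : LocallyIntegrableOn u Ω
  locallyIntegrable_deriv : LocallyIntegrableOn v Ω
  integral_eq : ∀ φ : EuclideanSpace ℝ (Fin d) → ℝ, IsTestFunction Ω φ →
    ∫ x in Ω, u x * fderiv ℝ φ x (EuclideanSpace.single i 1) = - ∫ x in Ω, v x * φ x

/-- `u` belongs to the Sobolev space `W¹_q(Ω)`, and `Du` is (a representative of) its weak
gradient. The weak gradient is unique up to equality almost everywhere on `Ω`. -/
structure MemW1 {d : ℕ} (Ω : Set (EuclideanSpace ℝ (Fin d))) (q : ℝ)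
    (u : EuclideanSpace ℝ (Fin d) → ℝ)
    (Du : EuclideanSpace ℝ (Fin d) → EuclideanSpace ℝ (Fin d)) : Prop where
  memLp : MemLp u (ENNReal.ofReal q) (volume.restrict Ω)
  memLp_grad : MemLp Du (ENNReal.ofReal q) (volume.restrict Ω)
  hasWeakPartialDeriv : ∀ i : Fin d, HasWeakPartialDeriv Ω i u (fun x => Du x i)

/-- `Ω` is `γ`-Reifenberg flat up to scale `R₀`: for every boundary point `x₀` and every
`0 < R ≤ R₀` there is a coordinate system `Φ` (a rigid motion `y ↦ Φ y`, depending on `x₀` and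
`R`) in which, with first coordinates written as `(Φ y) 0`,
`{x₀₁ + γ R < y₁} ∩ B_R(x₀) ⊆ Ω ∩ B_R(x₀) ⊆ {x₀₁ - γ R < y₁} ∩ B_R(x₀)`. -/
def IsReifenbergFlat {d : ℕ} [NeZero d] (γ R₀ : ℝ) (Ω : Set (EuclideanSpace ℝ (Fin d))) : Prop :=
  ∀ x₀ ∈ frontier Ω, ∀ R : ℝ, 0 < R → R ≤ R₀ →
    ∃ Φ : EuclideanSpace ℝ (Fin d) ≃ᵃⁱ[ℝ] EuclideanSpace ℝ (Fin d),
      {y | (Φ x₀) 0 + γ * R < (Φ y) 0} ∩ Metric.ball x₀ R ⊆ Ω ∩ Metric.ball x₀ R ∧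
      Ω ∩ Metric.ball x₀ R ⊆ {y | (Φ x₀) 0 - γ * R < (Φ y) 0} ∩ Metric.ball x₀ R

end Reifenberg

/-! Reifenberg flatness does not make the boundary a graph, but it does let every point x of Ω ∩
B_R(x₀) be reached by a chain of balls of radius r_k/16, r_k = R/2^k, whose first ball does not
depend on x. Consecutive balls lie in a common convex subset of Ω ∩ B_{2R}(x₀) within distance 3r_k
of x (`exists_chain`). A chain for x near the boundary hovers over the boundary point p nearest to x
until r_k is comparable to |x - p|, and then stays centred at x; the convex sets are caps cut from
balls by the flatness condition, or balls around x.

When a ball moves affinely inside a convex set, the derivative of the smooth average of u over it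
is, after integration by parts, an integral of Du against a bounded kernel. This uses only the weak
gradient, so no approximation of u by smooth functions is needed (`abs_smoothAverage_sub_le`). By
Lebesgue differentiation the averages along the chain tend to u(x) for almost every x, and
telescoping bounds |u(x) - c| by a constant times the dyadic Riesz potential Σ r_k ⨍ |Du| over the
balls B(x, 3r_k), where Du is cut off outside Ω ∩ B_{2R}(x₀) and c is the average over the common
first ball (`exists_edist_le_tsum_laverage`).

What remains is the Hardy–Littlewood–Sobolev inequality for that potential, proved by Hedberg's
trick (`exists_tsum_le_rpow_mul_rpow`): a term is at most r_k times the maximal function of |Du|,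
and by Hölder at most a constant times r_k^(1-d/q) ‖Du‖_q. Summing the smaller bound and raising to
the power dq/(d-q) leaves the maximal function to the power q exactly, so the strong type estimate
`lintegral_maximalFunction_rpow_le` applies. Replacing c by the mean value costs a factor two
(`eLpNorm_sub_average_le`). -/

namespace Reifenberg

/-! ### Geometry: caps, flatness and chains of balls -/

section Geometry

variable {E : Type*} [NormedAddCommGroup E] [InnerProductSpace ℝ E]

/-- The part of the ball `B_s(p)` lying at height more than `s / 48` in the direction `n`. -/
def cap (p : E) (s : ℝ) (n : E) : Set E :=
  {y | s / 48 < inner ℝ n (y - p)} ∩ Metric.ball p s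

/-- Flatness of `Ω` at the point `p` and the scale `s`, with inner normal direction `n`. -/
structure FlatAt (Ω : Set E) (p : E) (s : ℝ) (n : E) : Prop where
  norm_eq : ‖n‖ = 1
  cap_subset : cap p s n ⊆ Ω
  lt_inner : ∀ y ∈ Ω, y ∈ Metric.ball p s → -(s / 48) < inner ℝ n (y - p)

theorem convex_cap (p : E) (s : ℝ) (n : E) : Convex ℝ (cap p s n) := by
  refine Convex.inter ?_ (convex_ball p s)
  have h : {y | s / 48 < inner ℝ n (y - p)} = {y | s / 48 + inner ℝ n p < inner ℝ n y} := by
    ext y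
    simp only [mem_ofPred_eq, inner_sub_right]
    constructor <;> intro h <;> linarith
  rw [h]
  exact convex_halfSpace_gt (innerₛₗ ℝ n).isLinear _

theorem ball_subset_cap {p n z : E} {s ρ : ℝ} (hn : ‖n‖ = 1) (hd : ‖z - p‖ + ρ ≤ s)
    (hi : s / 48 + ρ ≤ inner ℝ n (z - p)) : Metric.ball z ρ ⊆ cap p s n := by
  intro y hy
  rw [mem_ball_iff_norm] at hy
  have h1 : y - p = (y - z) + (z - p) := by abel
  constructor
  · have h2 : -‖y - z‖ ≤ inner ℝ n (y - z) := by
      have := abs_real_inner_le_norm n (y - z)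
      rw [hn, one_mul] at this
      exact (abs_le.mp this).1
    simp only [mem_ofPred_eq]
    rw [h1, inner_add_right]
    linarith
  · rw [mem_ball_iff_norm, h1]
    exact (norm_add_le _ _).trans_lt (by linarith)

namespace FlatAt

variable {Ω : Set E} {p n : E} {s : ℝ}

theorem inner_self_eq_one (h : FlatAt Ω p s n) : inner ℝ n n = 1 := by
  rw [real_inner_self_eq_norm_sq, h.norm_eq]; norm_num

/-- A ball inside `Ω` at scale `s` has its centre well above the flat approximation. -/
theorem sub_le_inner (h : FlatAt Ω p s n) {z : E} {ρ : ℝ} (hρ : 0 < ρ)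
    (hz : Metric.ball z ρ ⊆ Ω ∩ Metric.ball p s) : ρ - s / 48 ≤ inner ℝ n (z - p) := by
  by_contra! hlt
  have hz0 := hz (Metric.mem_ball_self hρ)
  have h0 := h.lt_inner z hz0.1 hz0.2
  -- Lowering z by τ brings it to height exactly -s/48, which flatness forbids; since τ < ρ the
  -- lowered point is still in the ball.
  obtain ⟨τ, hτ⟩ : ∃ τ, τ = inner ℝ n (z - p) + s / 48 := ⟨_, rfl⟩
  have hmem : z - τ • n ∈ Metric.ball z ρ := by
    rw [mem_ball_iff_norm]
    have : z - τ • n - z = -(τ • n) := by abel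
    rw [this, norm_neg, norm_smul, h.norm_eq, mul_one, Real.norm_eq_abs, abs_lt]
    constructor <;> linarith
  have h1 := h.lt_inner _ (hz hmem).1 (hz hmem).2
  have h2 : z - τ • n - p = (z - p) - τ • n := by abel
  rw [h2, inner_sub_right, inner_smul_right, h.inner_self_eq_one] at h1
  linarith

/-- The normal directions at two consecutive dyadic scales are close. -/
theorem lt_inner_normals (h : FlatAt Ω p s n) {n' : E} (h' : FlatAt Ω p (s / 2) n')
    (hs : 0 < s) : 7 / 12 < inner ℝ n n' := by
  by_contra! hle
  set c := inner ℝ n n' with hc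
  have hc' : inner ℝ n' n = c := real_inner_comm _ _
  have hnorm : ‖n' - n‖ ≤ 2 := by
    refine (norm_sub_le _ _).trans ?_
    rw [h.norm_eq, h'.norm_eq]; norm_num
  -- If c ≤ 7/12, this point has height at least s/12 along n' and at most -s/12 along n: inside Ω
  -- by flatness at scale s/2, outside by flatness at scale s. The factor 1/5 keeps it within s/2 of
  -- p.
  have hyp : p + (s / 5) • (n' - n) - p = (s / 5) • (n' - n) := by abel
  have hn : ‖(s / 5) • (n' - n)‖ < s / 2 := by
    rw [norm_smul, Real.norm_eq_abs, abs_of_pos (by positivity)]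
    nlinarith
  have hmem : p + (s / 5) • (n' - n) ∈ Ω := by
    apply h'.cap_subset
    refine ⟨?_, ?_⟩
    · simp only [mem_ofPred_eq]
      rw [hyp, inner_smul_right, inner_sub_right, h'.inner_self_eq_one, hc']
      nlinarith
    · rwa [mem_ball_iff_norm, hyp]
  have h2 := h.lt_inner _ hmem (by rw [mem_ball_iff_norm, hyp]; linarith)
  rw [hyp, inner_smul_right, inner_sub_right, h.inner_self_eq_one] at h2
  nlinarith

theorem ball_subset_cap_of_le (h : FlatAt Ω p s n) (hs : 0 < s) {ρ : ℝ} (hρ : ρ ≤ s / 4) :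
    Metric.ball (p + (s / 2) • n) ρ ⊆ cap p s n := by
  have h1 : p + (s / 2) • n - p = (s / 2) • n := by abel
  apply ball_subset_cap h.norm_eq
  · rw [h1, norm_smul, h.norm_eq, Real.norm_eq_abs, abs_of_pos (by positivity)]
    linarith
  · rw [h1, inner_smul_right, h.inner_self_eq_one]
    linarith

/-- Since consecutive normals are close, the ball hovering over p at scale s/2 still lies in the
convex cap of scale s. This is one downward step of the chain. -/
theorem ball_half_subset_cap (h : FlatAt Ω p s n) {n' : E} (h' : FlatAt Ω p (s / 2) n')
    (hs : 0 < s) : Metric.ball (p + (s / 2 / 2) • n') (s / 32) ⊆ cap p s n := by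
  have h1 : p + (s / 2 / 2) • n' - p = (s / 2 / 2) • n' := by abel
  have h2 := h.lt_inner_normals h' hs
  apply ball_subset_cap h.norm_eq
  · rw [h1, norm_smul, h'.norm_eq, Real.norm_eq_abs, abs_of_pos (by positivity)]
    linarith
  · rw [h1, inner_smul_right]
    nlinarith

/-- A point whose distance `δ` to the complement of `Ω` is attained at `p` lies over `p`. -/
theorem ball_subset_cap_of_nearest (h : FlatAt Ω p s n) {x : E} {δ : ℝ} (hδ : 0 < δ)
    (hx : ‖x - p‖ = δ) (hΩ : Metric.ball x δ ⊆ Ω) (h1 : 2 * δ ≤ s) (h2 : s ≤ 4 * δ) :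
    Metric.ball x (s / 32) ⊆ cap p s n := by
  have h3 : δ - s / 48 ≤ inner ℝ n (x - p) := by
    refine h.sub_le_inner hδ (subset_inter hΩ (Metric.ball_subset_ball' ?_))
    rw [dist_eq_norm, hx]; linarith
  apply ball_subset_cap h.norm_eq
  · rw [hx]; linarith
  · linarith

/-- A ball of radius s/16 inside Ω has its centre at height at least s/16 - s/48 = s/24, so a
smaller concentric ball clears the cap's floor s/48. This links the fixed first ball to the rest of
the chain. -/
theorem ball_subset_cap_of_ball_subset (h : FlatAt Ω p s n) (hs : 0 < s) {z : E}
    (hz : Metric.ball z (s / 16) ⊆ Ω ∩ Metric.ball p s) {ρ : ℝ}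
    (hd : ‖z - p‖ + ρ ≤ s) (hρ : ρ ≤ s / 64) : Metric.ball z ρ ⊆ cap p s n := by
  have h3 := h.sub_le_inner (by positivity) hz
  apply ball_subset_cap h.norm_eq <;> linarith

end FlatAt

/-- An interior point of a set with nonempty complement has a nearest boundary point. -/
theorem exists_nearest_frontier [ProperSpace E] {Ω : Set E} (hΩ : IsOpen Ω) {x x₀ : E}
    (hx : x ∈ Ω) (hx₀ : x₀ ∉ Ω) : ∃ p ∈ frontier Ω, 0 < ‖x - p‖ ∧ ‖x - p‖ ≤ ‖x - x₀‖ ∧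
      Metric.ball x ‖x - p‖ ⊆ Ω := by
  obtain ⟨p, hp, hpd⟩ := hΩ.isClosed_compl.exists_infDist_eq_dist ⟨x₀, hx₀⟩ x
  have hball : Metric.ball x ‖x - p‖ ⊆ Ω := by
    intro y hy
    by_contra hyΩ
    have := Metric.infDist_le_dist_of_mem (x := x) (show y ∈ Ωᶜ from hyΩ)
    rw [hpd, dist_eq_norm, dist_comm] at this
    rw [Metric.mem_ball] at hy
    linarith
  have hne : x ≠ p := fun h => hp (h ▸ hx)
  have hpos : 0 < ‖x - p‖ := norm_pos_iff.mpr (sub_ne_zero.mpr hne)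
  refine ⟨p, ?_, hpos, ?_, hball⟩
  · rw [hΩ.frontier_eq]
    refine ⟨?_, hp⟩
    apply closure_mono hball
    rw [closure_ball x hpos.ne', Metric.mem_closedBall, dist_comm, dist_eq_norm]
  · have := Metric.infDist_le_dist_of_mem (x := x) (show x₀ ∈ Ωᶜ from hx₀)
    rwa [hpd, dist_eq_norm, dist_eq_norm] at this

/-- Every point `x` of `Ω ∩ B_R(x₀)` is the limit of a chain of balls starting from a fixed one,
such that consecutive balls lie in a common convex subset of `Ω ∩ B_{2R}(x₀)` of comparable
size. -/
theorem exists_chain [ProperSpace E] {Ω : Set E} (hΩ : IsOpen Ω) {R₀ : ℝ}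
    (hflat : ∀ p ∈ frontier Ω, ∀ s, 0 < s → s ≤ R₀ → ∃ n, FlatAt Ω p s n) {x₀ : E}
    (hx₀ : x₀ ∈ frontier Ω) {R : ℝ} (hR : 0 < R) (hRR₀ : 2 * R ≤ R₀) :
    ∃ z₀ : E, ∀ x ∈ Ω ∩ Metric.ball x₀ R, ∃ z : ℕ → E, z 0 = z₀ ∧ ∀ k : ℕ, ∃ K : Set E,
      Convex ℝ K ∧ K ⊆ Ω ∩ Metric.ball x₀ (2 * R) ∧ K ⊆ Metric.closedBall x (3 * (R / 2 ^ k)) ∧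
      Metric.ball (z k) (R / 2 ^ k / 16) ⊆ K ∧
      Metric.ball (z (k + 1)) (R / 2 ^ (k + 1) / 16) ⊆ K := by
  obtain ⟨n₀, hn₀⟩ := hflat x₀ hx₀ (2 * R) (by linarith) hRR₀
  refine ⟨x₀ + (2 * R / 2) • n₀, ?_⟩
  rintro x ⟨hxΩ, hxR⟩
  rw [mem_ball_iff_norm] at hxR
  have hx₀Ω : x₀ ∉ Ω := by
    rw [hΩ.frontier_eq] at hx₀; exact hx₀.2
  obtain ⟨p, hp, hδ, hδR, hball⟩ := exists_nearest_frontier hΩ hxΩ hx₀Ω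
  set δ := ‖x - p‖ with hδdef
  have hr : ∀ k : ℕ, 0 < R / 2 ^ k := fun k => by positivity
  have hr_succ : ∀ k : ℕ, R / 2 ^ (k + 1) = R / 2 ^ k / 2 := fun k => by
    rw [pow_succ]; field_simp
  have hr_le : ∀ k : ℕ, R / 2 ^ k ≤ R := fun k =>
    div_le_self hR.le (one_le_pow₀ (by norm_num))
  have hr_le' : ∀ k : ℕ, R / 2 ^ (k + 1) ≤ R / 2 := fun k => by
    rw [hr_succ]; linarith [hr_le k]
  have hn : ∀ k : ℕ, ∃ n, FlatAt Ω p (R / 2 ^ k) n := fun k =>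
    hflat p hp _ (hr k) (by linarith [hr_le k])
  choose n hn using hn
  have hpx₀ : ‖p - x₀‖ ≤ δ + ‖x - x₀‖ := by
    have : p - x₀ = (x - x₀) - (x - p) := by abel
    rw [this]
    exact (norm_sub_le _ _).trans (by linarith)
  -- `P k` says that the chain is still over p at step k. The condition δ < R/8 keeps the caps at p,
  -- of radius at most R/2, inside B_{2R}(x₀).
  set P : ℕ → Prop := fun k => δ < R / 8 ∧ 2 * δ ≤ R / 2 ^ k with hP
  classical
  let w : ℕ → E := fun k => if P k then p + (R / 2 ^ k / 2) • n k else x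
  -- Index 0 is overridden so that all chains share their first ball, whatever x is.
  let z : ℕ → E := fun k => Nat.casesOn k (x₀ + (2 * R / 2) • n₀) (fun j => w (j + 1))
  have hcapΩ : ∀ k, P (k + 1) →
      cap p (R / 2 ^ (k + 1)) (n (k + 1)) ⊆ Ω ∩ Metric.ball x₀ (2 * R) := by
    intro k hk
    refine subset_inter (hn _).cap_subset (inter_subset_right.trans ?_)
    refine Metric.ball_subset_ball' ?_
    rw [dist_eq_norm]
    linarith [hr_le' k, hk.1]
  refine ⟨z, rfl, ?_⟩
  rintro (_ | k)
  · refine ⟨cap x₀ (2 * R) n₀, convex_cap _ _ _,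
      subset_inter hn₀.cap_subset inter_subset_right, ?_, ?_, ?_⟩
    · refine inter_subset_right.trans (Metric.ball_subset_closedBall.trans
        (Metric.closedBall_subset_closedBall' ?_))
      rw [dist_comm, dist_eq_norm]
      simp only [pow_zero, div_one]
      linarith
    · refine hn₀.ball_subset_cap_of_le (by linarith) ?_
      simp only [pow_zero, div_one]
      linarith
    · have hz1 : z (0 + 1) = w (0 + 1) := rfl
      rw [hz1]
      have hr1 : R / 2 ^ (0 + 1) = R / 2 := by norm_num
      by_cases hP1 : P (0 + 1)
      · have hw : w (0 + 1) = p + (R / 2 ^ (0 + 1) / 2) • n (0 + 1) := if_pos hP1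
        rw [hw]
        refine hn₀.ball_subset_cap_of_ball_subset (by linarith)
          (((hn (0 + 1)).ball_subset_cap_of_le (hr _) ?_).trans (hcapΩ 0 hP1)) ?_ ?_
        · rw [hr1]; linarith
        · have h1 : p + (R / 2 ^ (0 + 1) / 2) • n (0 + 1) - x₀
              = (R / 2 ^ (0 + 1) / 2) • n (0 + 1) + ((x - x₀) - (x - p)) := by abel
          have h2 : ‖(R / 2 ^ (0 + 1) / 2) • n (0 + 1)‖ = R / 4 := by
            rw [norm_smul, (hn (0 + 1)).norm_eq, hr1, Real.norm_eq_abs,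
              abs_of_pos (by positivity)]
            ring
          have h3 : ‖(x - x₀) - (x - p)‖ ≤ ‖x - x₀‖ + δ := norm_sub_le _ _
          rw [h1]
          refine (add_le_add_left (norm_add_le _ _) _).trans ?_
          rw [h2, hr1]
          linarith [hP1.1]
        · rw [hr1]; linarith
      · have hw : w (0 + 1) = x := if_neg hP1
        rw [hw]
        -- At index 1 the second clause of `P` follows from the first, so failure means δ ≥ R/8,
        -- which is 1/16 of the scale 2R.
        have hδ8 : R / 8 ≤ δ := by
          by_contra! hlt
          exact hP1 ⟨hlt, by rw [hr1]; linarith⟩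
        refine hn₀.ball_subset_cap_of_ball_subset (by linarith)
          (subset_inter ((Metric.ball_subset_ball (by linarith)).trans hball)
            (Metric.ball_subset_ball' ?_)) ?_ ?_
        · rw [dist_eq_norm]; linarith
        · rw [hr1]; linarith
        · rw [hr1]; linarith
  · have hzk : ∀ j, z (j + 1) = w (j + 1) := fun _ => rfl
    rw [hzk, hzk]
    by_cases hPk : P (k + 1)
    · refine ⟨cap p (R / 2 ^ (k + 1)) (n (k + 1)), convex_cap _ _ _, hcapΩ k hPk, ?_, ?_, ?_⟩
      · refine inter_subset_right.trans (Metric.ball_subset_closedBall.trans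
          (Metric.closedBall_subset_closedBall' ?_))
        rw [dist_comm, dist_eq_norm]
        linarith [hPk.2, hr (k + 1)]
      · have hw : w (k + 1) = p + (R / 2 ^ (k + 1) / 2) • n (k + 1) := if_pos hPk
        rw [hw]
        exact (hn _).ball_subset_cap_of_le (hr _) (by linarith [hr (k + 1)])
      · by_cases hPk' : P (k + 1 + 1)
        · have hw : w (k + 1 + 1) = p + (R / 2 ^ (k + 1 + 1) / 2) • n (k + 1 + 1) := if_pos hPk'
          rw [hw]
          have h' := hn (k + 1 + 1)
          rw [hr_succ (k + 1)] at h' ⊢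
          have := (hn (k + 1)).ball_half_subset_cap h' (hr _)
          refine (Metric.ball_subset_ball ?_).trans this
          linarith [hr (k + 1)]
        · have hw : w (k + 1 + 1) = x := if_neg hPk'
          rw [hw]
          -- Transition step: this is the last scale over p, so it is comparable to δ and its cap
          -- also contains a ball around x.
          have h4 : R / 2 ^ (k + 1) ≤ 4 * δ := by
            by_contra! hlt
            exact hPk' ⟨hPk.1, by rw [hr_succ (k + 1)]; linarith⟩
          refine (Metric.ball_subset_ball ?_).trans
            ((hn (k + 1)).ball_subset_cap_of_nearest hδ rfl hball hPk.2 h4)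
          rw [hr_succ (k + 1)]; linarith
    · have hPk' : ¬ P (k + 1 + 1) := fun h =>
        hPk ⟨h.1, h.2.trans (by rw [hr_succ (k + 1)]; linarith [hr (k + 1)])⟩
      have hw : w (k + 1) = x := if_neg hPk
      have hw' : w (k + 1 + 1) = x := if_neg hPk'
      rw [hw, hw']
      have hle : R / 2 ^ (k + 1) / 16 ≤ δ := by
        by_contra! hlt
        refine hPk ⟨?_, ?_⟩ <;> linarith [hr_le' k]
      refine ⟨Metric.ball x (R / 2 ^ (k + 1) / 16), convex_ball _ _,
        subset_inter ((Metric.ball_subset_ball hle).trans hball) (Metric.ball_subset_ball' ?_),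
        Metric.ball_subset_closedBall.trans (Metric.closedBall_subset_closedBall ?_),
        le_rfl, Metric.ball_subset_ball ?_⟩
      · rw [dist_eq_norm]; linarith
      · linarith [hr (k + 1)]
      · rw [hr_succ (k + 1)]; linarith [hr (k + 1)]

end Geometry

/-- The normal is the preimage of the first basis vector under the linear part of Φ, so heights
along it are differences of first coordinates; γ ≤ 1/48 then lets the fixed width s/48 replace γs.
-/
theorem IsReifenbergFlat.exists_flatAt {d : ℕ} [NeZero d] {γ R₀ : ℝ}
    {Ω : Set (EuclideanSpace ℝ (Fin d))} (h : IsReifenbergFlat γ R₀ Ω) (hγ : γ ≤ 1 / 48)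
    {p : EuclideanSpace ℝ (Fin d)} (hp : p ∈ frontier Ω) {s : ℝ} (hs : 0 < s) (hsR : s ≤ R₀) :
    ∃ n, FlatAt Ω p s n := by
  obtain ⟨Φ, h1, h2⟩ := h p hp s hs hsR
  have hγs : γ * s ≤ s / 48 := by nlinarith
  set n := Φ.linearIsometryEquiv.symm (EuclideanSpace.single 0 1) with hn
  have hinner : ∀ y, inner ℝ n (y - p) = (Φ y) 0 - (Φ p) 0 := by
    intro y
    have e1 : Φ.linearIsometryEquiv (y - p) = Φ y - Φ p := by
      exact Φ.map_vsub y p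
    rw [hn, ← Φ.linearIsometryEquiv.inner_map_map, LinearIsometryEquiv.apply_symm_apply, e1, EuclideanSpace.inner_single_left]
    simp
  refine ⟨n, ?_, ?_, ?_⟩
  · rw [hn, LinearIsometryEquiv.norm_map]; simp
  · rintro y ⟨hy, hyb⟩
    refine (h1 ⟨?_, hyb⟩).1
    simp only [mem_ofPred_eq] at hy ⊢
    rw [hinner] at hy
    linarith
  · intro y hy hyb
    have := (h2 ⟨hy, hyb⟩).1
    simp only [mem_ofPred_eq] at this
    rw [hinner]
    linarith

/-! ### Smooth averages and their kernels -/

section Averages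

variable {d : ℕ}

/-- A smooth averaging kernel supported in the ball of radius `1 / 2`. -/
structure IsAveragingKernel (ψ : EuclideanSpace ℝ (Fin d) → ℝ) : Prop where
  contDiff : ContDiff ℝ ∞ ψ
  tsupport_subset : tsupport ψ ⊆ Metric.closedBall 0 (1 / 2)
  integral_eq_one : ∫ x, ψ x = 1

theorem exists_isAveragingKernel (d : ℕ) :
    ∃ ψ : EuclideanSpace ℝ (Fin d) → ℝ, IsAveragingKernel ψ := by
  let f : ContDiffBump (0 : EuclideanSpace ℝ (Fin d)) := ⟨1 / 4, 1 / 2, by norm_num, by norm_num⟩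
  exact ⟨f.normed volume, f.contDiff_normed, f.tsupport_normed_eq.subset, f.integral_normed⟩

namespace IsAveragingKernel

variable {ψ : EuclideanSpace ℝ (Fin d) → ℝ}

theorem hasCompactSupport (h : IsAveragingKernel ψ) : HasCompactSupport ψ :=
  (isCompact_closedBall 0 (1 / 2)).of_isClosed_subset (isClosed_tsupport ψ) h.tsupport_subset

theorem exists_bound (h : IsAveragingKernel ψ) : ∃ M, 0 < M ∧ ∀ x, |ψ x| ≤ M := by
  obtain ⟨C, hC⟩ := h.hasCompactSupport.exists_bound_of_continuous h.contDiff.continuous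
  refine ⟨max C 1, by positivity, fun x => (hC x).trans (le_max_left _ _)⟩

theorem exists_bound_fderiv (h : IsAveragingKernel ψ) :
    ∃ M, 0 < M ∧ ∀ x, ‖fderiv ℝ ψ x‖ ≤ M := by
  obtain ⟨C, hC⟩ := (h.hasCompactSupport.fderiv ℝ).exists_bound_of_continuous
    (h.contDiff.continuous_fderiv (by simp))
  refine ⟨max C 1, by positivity, fun x => (hC x).trans (le_max_left _ _)⟩

theorem norm_le_of_mem_tsupport (h : IsAveragingKernel ψ) {w : EuclideanSpace ℝ (Fin d)} (hw : w ∈ tsupport ψ) :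
    ‖w‖ ≤ 1 / 2 := by
  simpa using h.tsupport_subset hw

theorem eq_zero (h : IsAveragingKernel ψ) {w : EuclideanSpace ℝ (Fin d)} (hw : 1 / 2 < ‖w‖) : ψ w = 0 := by
  by_contra hne
  exact absurd (h.norm_le_of_mem_tsupport (subset_tsupport ψ hne)) (not_le.mpr hw)

theorem fderiv_eq_zero (h : IsAveragingKernel ψ) {w : EuclideanSpace ℝ (Fin d)} (hw : 1 / 2 < ‖w‖) :
    fderiv ℝ ψ w = 0 := by
  by_contra hne
  exact absurd (h.norm_le_of_mem_tsupport (support_fderiv_subset ℝ hne)) (not_le.mpr hw)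

end IsAveragingKernel

/-- The kernel `ψ` rescaled to the ball of centre `z` and radius `ρ`. -/
noncomputable def rescale (ψ : EuclideanSpace ℝ (Fin d) → ℝ) (z : EuclideanSpace ℝ (Fin d)) (ρ : ℝ) (y : EuclideanSpace ℝ (Fin d)) : ℝ :=
  (ρ ^ d)⁻¹ * ψ (ρ⁻¹ • (y - z))

/-- The smooth average of `u` over the ball of centre `z` and radius `ρ`. -/
noncomputable def smoothAverage (W : Set (EuclideanSpace ℝ (Fin d))) (ψ u : EuclideanSpace ℝ (Fin d) → ℝ) (z : EuclideanSpace ℝ (Fin d)) (ρ : ℝ) : ℝ :=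
  ∫ y in W, u y * rescale ψ z ρ y

theorem IsTestFunction.mono {Ω W : Set (EuclideanSpace ℝ (Fin d))} {φ : EuclideanSpace ℝ (Fin d) → ℝ} (h : IsTestFunction W φ) (hW : W ⊆ Ω) :
    IsTestFunction Ω φ :=
  ⟨h.smooth, h.hasCompactSupport, h.tsupport_subset.trans hW⟩

/-- Both integrands vanish off the support of the test function, so the integrals over Ω and over W
both equal the one over the whole space. -/
theorem HasWeakPartialDeriv.mono {Ω W : Set (EuclideanSpace ℝ (Fin d))} {i : Fin d} {u v : EuclideanSpace ℝ (Fin d) → ℝ}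
    (h : HasWeakPartialDeriv Ω i u v) (hW : W ⊆ Ω) : HasWeakPartialDeriv W i u v := by
  refine ⟨h.locallyIntegrable.mono_set hW, h.locallyIntegrable_deriv.mono_set hW, ?_⟩
  intro φ hφ
  have key : ∀ S : Set (EuclideanSpace ℝ (Fin d)), W ⊆ S → ∀ (f g : EuclideanSpace ℝ (Fin d) → ℝ), (∀ x, x ∉ tsupport φ → g x = 0) →
      ∫ x in S, f x * g x = ∫ x, f x * g x := by
    intro S hS f g hg
    refine setIntegral_eq_integral_of_forall_compl_eq_zero fun x hx => ?_
    rw [hg x fun hx' => hx (hS (hφ.tsupport_subset hx')), mul_zero]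
  have h1 : ∀ x, x ∉ tsupport φ → φ x = 0 := fun x hx => image_eq_zero_of_notMem_tsupport hx
  have h2 : ∀ x, x ∉ tsupport φ → fderiv ℝ φ x (EuclideanSpace.single i 1) = 0 := by
    intro x hx
    have : fderiv ℝ φ x = 0 := by
      by_contra hne
      exact hx (support_fderiv_subset ℝ hne)
    rw [this]; rfl
  have h3 := h.integral_eq φ (hφ.mono hW)
  rw [key Ω hW _ _ h1, key Ω hW u _ h2] at h3
  rw [key W le_rfl _ _ h1, key W le_rfl u _ h2, h3]

theorem LocallyIntegrableOn.integrable_mul {W : Set (EuclideanSpace ℝ (Fin d))} {u φ : EuclideanSpace ℝ (Fin d) → ℝ}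
    (hu : LocallyIntegrableOn u W) (hφ : Continuous φ) (hc : HasCompactSupport φ)
    (hs : tsupport φ ⊆ W) : Integrable (fun x => u x * φ x) := by
  have h1 : IntegrableOn u (tsupport φ) := hu.integrableOn_compact_subset hs hc
  have h2 : IntegrableOn (fun x => u x * φ x) (tsupport φ) :=
    h1.mul_continuousOn hφ.continuousOn hc
  refine (integrableOn_iff_integrable_of_support_subset ?_).mp h2
  intro x hx
  exact subset_tsupport φ (right_ne_zero_of_mul hx)

/-- Integration by parts against a smooth vector field compactly supported in `W`. -/
theorem integral_mul_divergence {W : Set (EuclideanSpace ℝ (Fin d))} {u : EuclideanSpace ℝ (Fin d) → ℝ} {Du : EuclideanSpace ℝ (Fin d) → EuclideanSpace ℝ (Fin d)}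
    (h : ∀ i, HasWeakPartialDeriv W i u (fun x => Du x i)) {F : Fin d → EuclideanSpace ℝ (Fin d) → ℝ}
    (hF : ∀ i, IsTestFunction W (F i)) :
    ∫ x in W, u x * ∑ i, fderiv ℝ (F i) x (EuclideanSpace.single i 1)
      = - ∫ x in W, ∑ i, Du x i * F i x := by
  simp_rw [Finset.mul_sum]
  rw [integral_finsetSum, integral_finsetSum, ← Finset.sum_neg_distrib]
  · exact Finset.sum_congr rfl fun i _ => (h i).integral_eq _ (hF i)
  · intro i _
    exact (LocallyIntegrableOn.integrable_mul (h i).locallyIntegrable_deriv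
      (hF i).smooth.continuous (hF i).hasCompactSupport (hF i).tsupport_subset).integrableOn
  · intro i _
    refine (LocallyIntegrableOn.integrable_mul (h i).locallyIntegrable ?_ ?_ ?_).integrableOn
    · exact ((hF i).smooth.continuous_fderiv (by simp)).clm_apply continuous_const
    · exact (hF i).hasCompactSupport.fderiv_apply ℝ _
    · exact (tsupport_fderiv_apply_subset ℝ _).trans (hF i).tsupport_subset

section Field

variable {ψ : EuclideanSpace ℝ (Fin d) → ℝ} {z V : EuclideanSpace ℝ (Fin d)} {ρ Δ : ℝ}

theorem hasFDerivAt_kernel_mul (hψ : IsAveragingKernel ψ) (i : Fin d) (y : EuclideanSpace ℝ (Fin d)) :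
    HasFDerivAt (fun y : EuclideanSpace ℝ (Fin d) => ψ (ρ⁻¹ • (y - z)) * (V i + Δ * (ρ⁻¹ • (y - z)) i))
      (ψ (ρ⁻¹ • (y - z)) • (Δ • (ρ⁻¹ • (EuclideanSpace.proj i : EuclideanSpace ℝ (Fin d) →L[ℝ] ℝ)))
        + (V i + Δ * (ρ⁻¹ • (y - z)) i) •
          ((fderiv ℝ ψ (ρ⁻¹ • (y - z))).comp (ρ⁻¹ • ContinuousLinearMap.id ℝ (EuclideanSpace ℝ (Fin d))))) y := by
  have hw : HasFDerivAt (fun y : EuclideanSpace ℝ (Fin d) => ρ⁻¹ • (y - z)) (ρ⁻¹ • ContinuousLinearMap.id ℝ (EuclideanSpace ℝ (Fin d))) y :=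
    ((hasFDerivAt_id y).sub_const z).const_smul ρ⁻¹
  have h1 : HasFDerivAt (fun y : EuclideanSpace ℝ (Fin d) => ψ (ρ⁻¹ • (y - z))) _ y :=
    ((hψ.contDiff.differentiable (by simp)) (ρ⁻¹ • (y - z))).hasFDerivAt.comp y hw
  have h2 : HasFDerivAt (fun y : EuclideanSpace ℝ (Fin d) => V i + Δ * (ρ⁻¹ • (y - z)) i)
      (Δ • (ρ⁻¹ • (EuclideanSpace.proj i : EuclideanSpace ℝ (Fin d) →L[ℝ] ℝ))) y := by
    have h3 := (((EuclideanSpace.proj i : EuclideanSpace ℝ (Fin d) →L[ℝ] ℝ).hasFDerivAt.comp y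
      hw).const_mul Δ).const_add (V i)
    refine h3.congr_fderiv ?_
    ext v
    simp
  exact h1.mul h2

/-- The kernel lives on half the radius, so its closed support fits inside the open ball and the
field is admissible for integration by parts. -/
theorem isTestFunction_kernel_mul (hψ : IsAveragingKernel ψ) (hρ : 0 < ρ) {W : Set (EuclideanSpace ℝ (Fin d))}
    (hW : Metric.ball z ρ ⊆ W) (i : Fin d) :
    IsTestFunction W (fun y : EuclideanSpace ℝ (Fin d) => ψ (ρ⁻¹ • (y - z)) * (V i + Δ * (ρ⁻¹ • (y - z)) i)) := by
  set φ := fun y : EuclideanSpace ℝ (Fin d) => ψ (ρ⁻¹ • (y - z)) * (V i + Δ * (ρ⁻¹ • (y - z)) i)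
  have hs : tsupport φ ⊆ Metric.closedBall z (ρ / 2) := by
    refine closure_minimal ?_ Metric.isClosed_closedBall
    intro y hy
    have h1 : ψ (ρ⁻¹ • (y - z)) ≠ 0 := left_ne_zero_of_mul hy
    have h2 := hψ.norm_le_of_mem_tsupport (subset_tsupport ψ h1)
    rw [norm_smul, norm_inv, Real.norm_of_nonneg hρ.le, inv_mul_le_iff₀ hρ] at h2
    rw [mem_closedBall_iff_norm]
    linarith
  refine ⟨?_, (isCompact_closedBall z (ρ / 2)).of_isClosed_subset (isClosed_tsupport φ) hs,
    hs.trans ((Metric.closedBall_subset_ball (by linarith)).trans hW)⟩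
  have hw : ContDiff ℝ ∞ (fun y : EuclideanSpace ℝ (Fin d) => ρ⁻¹ • (y - z)) :=
    (contDiff_id.sub contDiff_const).const_smul _
  refine (hψ.contDiff.comp hw).mul (contDiff_const.add (contDiff_const.mul ?_))
  exact (EuclideanSpace.proj i : EuclideanSpace ℝ (Fin d) →L[ℝ] ℝ).contDiff.comp hw

theorem sum_fderiv_kernel_mul (hψ : IsAveragingKernel ψ) (y : EuclideanSpace ℝ (Fin d)) :
    ∑ i, fderiv ℝ (fun y : EuclideanSpace ℝ (Fin d) => ψ (ρ⁻¹ • (y - z)) * (V i + Δ * (ρ⁻¹ • (y - z)) i)) y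
        (EuclideanSpace.single i 1)
      = ρ⁻¹ * (d * Δ * ψ (ρ⁻¹ • (y - z))
        + fderiv ℝ ψ (ρ⁻¹ • (y - z)) (V + Δ • (ρ⁻¹ • (y - z)))) := by
  set w := ρ⁻¹ • (y - z)
  have h1 : V + Δ • w = ∑ i, (V i + Δ * w i) • EuclideanSpace.single i (1 : ℝ) := by
    ext j
    simp [Finset.sum_apply, Pi.single_apply]
  rw [h1, map_sum, mul_add, Finset.mul_sum]
  have h2 : ∀ i, fderiv ℝ (fun y : EuclideanSpace ℝ (Fin d) => ψ (ρ⁻¹ • (y - z)) * (V i + Δ * (ρ⁻¹ • (y - z)) i)) y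
        (EuclideanSpace.single i 1)
      = ρ⁻¹ * (Δ * ψ w) + ρ⁻¹ * fderiv ℝ ψ w ((V i + Δ * w i) • EuclideanSpace.single i 1) := by
    intro i
    rw [(hasFDerivAt_kernel_mul hψ i y).fderiv]
    simp [w]
    ring
  simp_rw [h2]
  rw [Finset.sum_add_distrib]
  simp
  ring

/-- This is a continuity equation: the rescaled kernel is transported by the velocity V + Δw, w
being the relative position in the ball, so its time derivative is minus the divergence of kernel
times velocity, as computed in `sum_fderiv_kernel_mul`. -/
theorem hasDerivAt_rescale (hψ : IsAveragingKernel ψ) (y : EuclideanSpace ℝ (Fin d)) {t : ℝ} (ht : ρ + t * Δ ≠ 0) :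
    HasDerivAt (fun t : ℝ => rescale ψ (z + t • V) (ρ + t * Δ) y)
      (-(((ρ + t * Δ) ^ d)⁻¹ * ((ρ + t * Δ)⁻¹ *
        (d * Δ * ψ ((ρ + t * Δ)⁻¹ • (y - (z + t • V)))
          + fderiv ℝ ψ ((ρ + t * Δ)⁻¹ • (y - (z + t • V)))
              (V + Δ • ((ρ + t * Δ)⁻¹ • (y - (z + t • V)))))))) t := by
  have h1 : HasDerivAt (fun t : ℝ => ρ + t * Δ) Δ t := by
    simpa using ((hasDerivAt_id t).mul_const Δ).const_add ρ
  have h2 : HasDerivAt (fun t : ℝ => y - (z + t • V)) (-V) t := by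
    simpa using (((hasDerivAt_id t).smul_const V).const_add z).const_sub y
  have h3 := h1.inv ht
  have h4 : HasDerivAt (fun t : ℝ => (ρ + t * Δ)⁻¹ • (y - (z + t • V)))
      (-((ρ + t * Δ)⁻¹ • (V + Δ • ((ρ + t * Δ)⁻¹ • (y - (z + t • V)))))) t := by
    refine (h3.smul h2).congr_deriv ?_
    simp only [smul_neg, smul_add, smul_smul, neg_div, neg_smul, neg_add]
    congr 3
    rw [div_eq_mul_inv, pow_two, mul_inv]
    ring
  have h5 := ((hψ.contDiff.differentiable (by simp))
    ((ρ + t * Δ)⁻¹ • (y - (z + t • V)))).hasFDerivAt.comp_hasDerivAt t h4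
  have h6 := (h1.pow d).inv (pow_ne_zero d ht)
  have h7 := h6.mul h5
  unfold rescale
  refine h7.congr_deriv ?_
  rw [map_neg, map_smul, smul_eq_mul]
  -- The power rule produces the truncated exponent d - 1, hence the separate case d = 0.
  rcases d with _ | d
  · simp
  · simp only [Pi.inv_apply, Pi.pow_apply, Function.comp_apply, Nat.add_sub_cancel]
    field_simp
    ring

end Field

end Averages

/-- A point of the intermediate ball is the convex combination of the points with the same relative
position v in the two end balls. -/
theorem ball_lineMap_subset {E : Type*} [NormedAddCommGroup E] [NormedSpace ℝ E] {K : Set E}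
    (hK : Convex ℝ K) {z z' : E} {ρ ρ' t : ℝ} (hρ : 0 < ρ) (hρ' : 0 < ρ')
    (h : Metric.ball z ρ ⊆ K) (h' : Metric.ball z' ρ' ⊆ K) (ht : t ∈ Icc (0 : ℝ) 1) :
    Metric.ball (z + t • (z' - z)) (ρ + t * (ρ' - ρ)) ⊆ K := by
  intro y hy
  have hσ : 0 < ρ + t * (ρ' - ρ) := by
    have h1 := min_le_left ρ ρ'
    have h2 := min_le_right ρ ρ'
    have h3 : 0 < min ρ ρ' := lt_min hρ hρ'
    nlinarith [ht.1, ht.2]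
  set σ := ρ + t * (ρ' - ρ)
  set v := σ⁻¹ • (y - (z + t • (z' - z))) with hv
  have hv1 : ‖v‖ < 1 := by
    rw [mem_ball_iff_norm] at hy
    rw [hv, norm_smul, norm_inv, Real.norm_of_nonneg hσ.le, inv_mul_lt_iff₀ hσ]
    linarith
  have hmem : ∀ (c : E) (r : ℝ), 0 < r → c + r • v ∈ Metric.ball c r := by
    intro c r hr
    rw [mem_ball_iff_norm, add_sub_cancel_left, norm_smul, Real.norm_of_nonneg hr.le]
    nlinarith
  have hy' : y = (1 - t) • (z + ρ • v) + t • (z' + ρ' • v) := by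
    have : σ • v = y - (z + t • (z' - z)) := by rw [hv, smul_inv_smul₀ hσ.ne']
    have h2 : y = (z + t • (z' - z)) + σ • v := by rw [this]; abel
    rw [h2]
    simp only [σ]
    module
  rw [hy']
  exact hK (h (hmem z ρ hρ)) (h' (hmem z' ρ' hρ')) (by linarith [ht.2]) ht.1 (by ring)

/-! ### Variation of smooth averages along a moving ball -/

section Averages

variable {d : ℕ} {W : Set (EuclideanSpace ℝ (Fin d))} {u : EuclideanSpace ℝ (Fin d) → ℝ}
  {Du : EuclideanSpace ℝ (Fin d) → EuclideanSpace ℝ (Fin d)}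
  {ψ : EuclideanSpace ℝ (Fin d) → ℝ}

theorem integral_mul_kernel (hψ : IsAveragingKernel ψ)
    (h : ∀ i, HasWeakPartialDeriv W i u (fun x => Du x i)) {z V : EuclideanSpace ℝ (Fin d)}
    {ρ Δ : ℝ} (hρ : 0 < ρ) (hW : Metric.ball z ρ ⊆ W) :
    ∫ y in W, u y * -((ρ ^ d)⁻¹ * (ρ⁻¹ * (d * Δ * ψ (ρ⁻¹ • (y - z))
        + fderiv ℝ ψ (ρ⁻¹ • (y - z)) (V + Δ • (ρ⁻¹ • (y - z))))))
      = (ρ ^ d)⁻¹ *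
        ∫ y in W, ψ (ρ⁻¹ • (y - z)) * inner ℝ (Du y) (V + Δ • (ρ⁻¹ • (y - z))) := by
  have h1 := integral_mul_divergence h
    (fun i => isTestFunction_kernel_mul (V := V) (Δ := Δ) hψ hρ hW i)
  simp_rw [sum_fderiv_kernel_mul hψ] at h1
  have h2 : ∀ y, ∑ i, Du y i * (ψ (ρ⁻¹ • (y - z)) * (V i + Δ * (ρ⁻¹ • (y - z)) i))
      = ψ (ρ⁻¹ • (y - z)) * inner ℝ (Du y) (V + Δ • (ρ⁻¹ • (y - z))) := by
    intro y
    rw [PiLp.inner_apply, Finset.mul_sum]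
    refine Finset.sum_congr rfl fun i _ => ?_
    simp
    ring
  simp_rw [h2] at h1
  have h3 : ∀ y, u y * -((ρ ^ d)⁻¹ * (ρ⁻¹ * (d * Δ * ψ (ρ⁻¹ • (y - z))
        + fderiv ℝ ψ (ρ⁻¹ • (y - z)) (V + Δ • (ρ⁻¹ • (y - z))))))
      = -(ρ ^ d)⁻¹ * (u y * (ρ⁻¹ * (d * Δ * ψ (ρ⁻¹ • (y - z))
        + fderiv ℝ ψ (ρ⁻¹ • (y - z)) (V + Δ • (ρ⁻¹ • (y - z)))))) := fun y => by ring
  simp_rw [h3]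
  rw [integral_const_mul, h1]
  ring

/-- On the support of the kernel the relative position has norm at most 1/2, so the velocity is
bounded by ‖V‖ + |Δ| and only points of B contribute. -/
theorem norm_integral_kernel_le {M : ℝ} (hM0 : 0 ≤ M) (hM : ∀ x, |ψ x| ≤ M)
    (hψ : IsAveragingKernel ψ) (hDu : IntegrableOn Du W)
    {B : Set (EuclideanSpace ℝ (Fin d))} (hB : MeasurableSet B)
    {z V : EuclideanSpace ℝ (Fin d)} {ρ Δ : ℝ} (hρ : 0 < ρ) (hzB : Metric.ball z ρ ⊆ B) :
    ‖∫ y in W, ψ (ρ⁻¹ • (y - z)) * inner ℝ (Du y) (V + Δ • (ρ⁻¹ • (y - z)))‖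
      ≤ M * (‖V‖ + |Δ|) * ∫ y in W ∩ B, ‖Du y‖ := by
  have h1 : ∫ y in W ∩ B, ‖Du y‖ = ∫ y in W, B.indicator (fun y => ‖Du y‖) y := by
    rw [setIntegral_indicator hB]
  rw [h1, ← integral_const_mul]
  refine norm_integral_le_of_norm_le ((hDu.norm.indicator hB).const_mul _) ?_
  filter_upwards with y
  by_cases hy : 1 / 2 < ‖ρ⁻¹ • (y - z)‖
  · rw [hψ.eq_zero hy, zero_mul, norm_zero]
    exact mul_nonneg (by positivity) (indicator_nonneg (fun _ _ => norm_nonneg _) _)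
  · push Not at hy
    have hyB : y ∈ B := by
      apply hzB
      rw [norm_smul, norm_inv, Real.norm_of_nonneg hρ.le, inv_mul_le_iff₀ hρ] at hy
      rw [mem_ball_iff_norm]
      linarith
    rw [indicator_of_mem hyB, norm_mul, Real.norm_eq_abs]
    have h2 : ‖inner ℝ (Du y) (V + Δ • (ρ⁻¹ • (y - z)))‖ ≤ ‖Du y‖ * (‖V‖ + |Δ|) := by
      refine (norm_inner_le_norm _ _).trans ?_
      gcongr
      refine (norm_add_le _ _).trans ?_
      rw [norm_smul, Real.norm_eq_abs]
      have := abs_nonneg Δ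
      nlinarith
    calc _ ≤ M * (‖Du y‖ * (‖V‖ + |Δ|)) := by gcongr; exact hM _
      _ = _ := by ring

theorem hasDerivAt_smoothAverage (hψ : IsAveragingKernel ψ)
    (h : ∀ i, HasWeakPartialDeriv W i u (fun x => Du x i)) (hu : IntegrableOn u W)
    {z V : EuclideanSpace ℝ (Fin d)} {ρ Δ t : ℝ} (ht : 0 < ρ + t * Δ)
    (hW : Metric.ball (z + t • V) (ρ + t * Δ) ⊆ W) :
    HasDerivAt (fun t : ℝ => smoothAverage W ψ u (z + t • V) (ρ + t * Δ))
      (((ρ + t * Δ) ^ d)⁻¹ * ∫ y in W, ψ ((ρ + t * Δ)⁻¹ • (y - (z + t • V))) *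
        inner ℝ (Du y) (V + Δ • ((ρ + t * Δ)⁻¹ • (y - (z + t • V))))) t := by
  rw [← integral_mul_kernel hψ h ht hW]
  obtain ⟨M, hM0, hM⟩ := hψ.exists_bound
  obtain ⟨M', hM'0, hM'⟩ := hψ.exists_bound_fderiv
  -- Near t the radius stays above half its value at t, which gives a dominating function uniform in
  -- the parameter.
  set σ := (ρ + t * Δ) / 2 with hσ
  have hσ0 : 0 < σ := by positivity
  have hs : {s : ℝ | σ < ρ + s * Δ} ∈ nhds t := by
    refine (isOpen_lt continuous_const (by fun_prop)).mem_nhds ?_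
    change σ < ρ + t * Δ
    linarith
  have hcont : ∀ s : ℝ, Continuous (rescale ψ (z + s • V) (ρ + s * Δ)) := by
    intro s
    have := hψ.contDiff.continuous
    unfold rescale
    fun_prop
  have hbd : ∀ s : ℝ, 0 < ρ + s * Δ → ∀ y,
      ‖rescale ψ (z + s • V) (ρ + s * Δ) y‖ ≤ ((ρ + s * Δ) ^ d)⁻¹ * M := by
    intro s hs y
    unfold rescale
    rw [norm_mul, Real.norm_of_nonneg (by positivity), Real.norm_eq_abs]
    gcongr
    exact hM _
  unfold smoothAverage
  refine (hasDerivAt_integral_of_dominated_loc_of_deriv_le (𝕜 := ℝ) (E := ℝ)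
    (μ := volume.restrict W)
    (F := fun s y => u y * rescale ψ (z + s • V) (ρ + s * Δ) y)
    (F' := fun s y => u y * -(((ρ + s * Δ) ^ d)⁻¹ * ((ρ + s * Δ)⁻¹ *
        (d * Δ * ψ ((ρ + s * Δ)⁻¹ • (y - (z + s • V)))
          + fderiv ℝ ψ ((ρ + s * Δ)⁻¹ • (y - (z + s • V)))
              (V + Δ • ((ρ + s * Δ)⁻¹ • (y - (z + s • V))))))))
    (bound := fun y => ‖u y‖ * ((σ ^ d)⁻¹ * (σ⁻¹ * (d * |Δ| * M + M' * (‖V‖ + |Δ|)))))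
    hs ?_ ?_ ?_ ?_ ?_ ?_).2
  · exact Filter.Eventually.of_forall fun s =>
      hu.aestronglyMeasurable.mul (hcont s).aestronglyMeasurable
  · exact hu.mul_bdd (c := ((ρ + t * Δ) ^ d)⁻¹ * M) (hcont t).aestronglyMeasurable
      (Filter.Eventually.of_forall fun y => hbd t ht y)
  · refine hu.aestronglyMeasurable.mul (Continuous.aestronglyMeasurable ?_)
    have h1 := hψ.contDiff.continuous
    have h2 : Continuous (fderiv ℝ ψ) := hψ.contDiff.continuous_fderiv (by simp)
    fun_prop
  · filter_upwards with y s hs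
    replace hs : σ < ρ + s * Δ := hs
    have hs0 : 0 < ρ + s * Δ := hσ0.trans hs
    rw [norm_mul, norm_neg, norm_mul, norm_mul, norm_inv, norm_inv, norm_pow,
      Real.norm_of_nonneg (hσ0.trans hs).le]
    gcongr
    refine (norm_add_le _ _).trans ?_
    gcongr
    · rw [norm_mul, norm_mul, Real.norm_natCast, Real.norm_eq_abs, Real.norm_eq_abs]
      gcongr
      exact hM _
    · set w := (ρ + s * Δ)⁻¹ • (y - (z + s • V))
      by_cases hw : 1 / 2 < ‖w‖
      · rw [hψ.fderiv_eq_zero hw, zero_apply, norm_zero]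
        positivity
      · push Not at hw
        refine (ContinuousLinearMap.le_opNorm _ _).trans ?_
        gcongr
        · exact hM' _
        · refine (norm_add_le _ _).trans ?_
          rw [norm_smul, Real.norm_eq_abs]
          have := abs_nonneg Δ
          nlinarith
  · exact hu.norm.mul_const _
  · filter_upwards with y s hs
    replace hs : σ < ρ + s * Δ := hs
    exact (hasDerivAt_rescale hψ y (hσ0.trans hs).ne').const_mul (u y)

/-- The smooth averages over two balls contained in a convex set differ by at most an integral
of the gradient over that set. -/
theorem abs_smoothAverage_sub_le {M : ℝ} (hM0 : 0 ≤ M) (hM : ∀ x, |ψ x| ≤ M)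
    (hψ : IsAveragingKernel ψ) (h : ∀ i, HasWeakPartialDeriv W i u (fun x => Du x i))
    (hu : IntegrableOn u W) (hDu : IntegrableOn Du W)
    {K B : Set (EuclideanSpace ℝ (Fin d))} (hB : MeasurableSet B) (hK : Convex ℝ K)
    (hKW : K ⊆ W) (hKB : K ⊆ B) {z z' : EuclideanSpace ℝ (Fin d)} {ρ ρ' σ : ℝ} (hσ : 0 < σ)
    (hρ : σ ≤ ρ) (hρ' : σ ≤ ρ') (hz : Metric.ball z ρ ⊆ K) (hz' : Metric.ball z' ρ' ⊆ K) :
    |smoothAverage W ψ u z' ρ' - smoothAverage W ψ u z ρ|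
      ≤ (σ ^ d)⁻¹ * (M * (‖z' - z‖ + |ρ' - ρ|) * ∫ y in W ∩ B, ‖Du y‖) := by
  have hpos : ∀ t ∈ Icc (0 : ℝ) 1, σ ≤ ρ + t * (ρ' - ρ) := by
    intro t ht
    nlinarith [ht.1, ht.2]
  have hball : ∀ t ∈ Icc (0 : ℝ) 1, Metric.ball (z + t • (z' - z)) (ρ + t * (ρ' - ρ)) ⊆ K :=
    fun t ht => ball_lineMap_subset hK (hσ.trans_le hρ) (hσ.trans_le hρ') hz hz' ht
  have hint : 0 ≤ ∫ y in W ∩ B, ‖Du y‖ := integral_nonneg fun _ => norm_nonneg _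
  have key := norm_image_sub_le_of_norm_deriv_le_segment_01'
    (f := fun t : ℝ => smoothAverage W ψ u (z + t • (z' - z)) (ρ + t * (ρ' - ρ)))
    (fun t ht => (hasDerivAt_smoothAverage hψ h hu (hσ.trans_le (hpos t ht))
      ((hball t ht).trans hKW)).hasDerivWithinAt)
    (C := (σ ^ d)⁻¹ * (M * (‖z' - z‖ + |ρ' - ρ|) * ∫ y in W ∩ B, ‖Du y‖)) ?_
  · simpa using key
  · intro t ht
    have ht' : t ∈ Icc (0 : ℝ) 1 := Ico_subset_Icc_self ht
    have h1 := hpos t ht'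
    rw [norm_mul, norm_inv, norm_pow, Real.norm_of_nonneg (hσ.trans_le h1).le]
    gcongr
    exact norm_integral_kernel_le hM0 hM hψ hDu hB (hσ.trans_le h1)
      ((hball t ht').trans hKB)

end Averages

/-! ### Pointwise bound by a dyadic potential of the gradient -/

section Pointwise

open Filter Topology ENNReal

variable {d : ℕ} {W : Set (EuclideanSpace ℝ (Fin d))} {u : EuclideanSpace ℝ (Fin d) → ℝ}
  {Du : EuclideanSpace ℝ (Fin d) → EuclideanSpace ℝ (Fin d)}
  {ψ : EuclideanSpace ℝ (Fin d) → ℝ}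

theorem integral_rescale (hψ : IsAveragingKernel ψ) (z : EuclideanSpace ℝ (Fin d)) {ρ : ℝ}
    (hρ : 0 < ρ) : ∫ y, rescale ψ z ρ y = 1 := by
  unfold rescale
  rw [integral_const_mul, integral_sub_right_eq_self (fun y => ψ (ρ⁻¹ • y)) z,
    Measure.integral_comp_inv_smul_of_nonneg _ _ hρ.le, hψ.integral_eq_one]
  simp only [finrank_euclideanSpace, Fintype.card_fin, smul_eq_mul, mul_one]
  exact inv_mul_cancel₀ (by positivity)

theorem rescale_eq_zero (hψ : IsAveragingKernel ψ) {z y : EuclideanSpace ℝ (Fin d)} {ρ : ℝ}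
    (hρ : 0 < ρ) (hy : y ∉ Metric.closedBall z ρ) : rescale ψ z ρ y = 0 := by
  unfold rescale
  rw [hψ.eq_zero, mul_zero]
  rw [norm_smul, norm_inv, Real.norm_of_nonneg hρ.le, lt_inv_mul_iff₀ hρ]
  rw [mem_closedBall_iff_norm] at hy
  linarith

theorem norm_rescale_le {M : ℝ} (hM : ∀ x, |ψ x| ≤ M) (z y : EuclideanSpace ℝ (Fin d))
    {ρ : ℝ} (hρ : 0 < ρ) : ‖rescale ψ z ρ y‖ ≤ (ρ ^ d)⁻¹ * M := by
  unfold rescale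
  rw [norm_mul, Real.norm_of_nonneg (by positivity), Real.norm_eq_abs]
  gcongr
  exact hM _

theorem continuous_rescale (hψ : IsAveragingKernel ψ) (z : EuclideanSpace ℝ (Fin d)) (ρ : ℝ) :
    Continuous (rescale ψ z ρ) := by
  have := hψ.contDiff.continuous
  unfold rescale
  fun_prop

theorem volume_real_closedBall (z : EuclideanSpace ℝ (Fin d)) {ρ : ℝ} (hρ : 0 < ρ) :
    volume.real (Metric.closedBall z ρ)
      = ρ ^ d * volume.real (Metric.ball (0 : EuclideanSpace ℝ (Fin d)) 1) := by
  rw [Measure.addHaar_real_closedBall _ _ hρ.le]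
  simp

/-- The rescaled kernel has unit mass, is supported in the ball and is bounded by M/ρ^d, which is a
constant over the volume. Ordinary Lebesgue points therefore suffice for smooth averages. -/
theorem abs_smoothAverage_sub_le_average {M : ℝ} (hM : ∀ x, |ψ x| ≤ M)
    (hψ : IsAveragingKernel ψ) (hu : IntegrableOn u W) (hW : MeasurableSet W) (a : ℝ)
    (z : EuclideanSpace ℝ (Fin d)) {ρ : ℝ} (hρ : 0 < ρ) :
    |smoothAverage W ψ u z ρ - a| ≤
      M * volume.real (Metric.ball (0 : EuclideanSpace ℝ (Fin d)) 1) *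
        ⨍ y in Metric.closedBall z ρ, ‖W.indicator u y - a‖ := by
  have hu' : Integrable (W.indicator u) := hu.integrable_indicator hW
  have hr : Integrable (rescale ψ z ρ) := by
    refine (continuous_rescale hψ z ρ).integrable_of_hasCompactSupport ?_
    exact HasCompactSupport.intro (isCompact_closedBall z ρ) fun y hy =>
      rescale_eq_zero hψ hρ hy
  have hur : Integrable (fun y => W.indicator u y * rescale ψ z ρ y) :=
    hu'.mul_bdd (c := (ρ ^ d)⁻¹ * M) (continuous_rescale hψ z ρ).aestronglyMeasurable
      (Eventually.of_forall fun y => norm_rescale_le hM z y hρ)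
  have h1 : smoothAverage W ψ u z ρ - a
      = ∫ y in Metric.closedBall z ρ, (W.indicator u y - a) * rescale ψ z ρ y := by
    rw [setIntegral_eq_integral_of_forall_compl_eq_zero fun y hy => by
      rw [rescale_eq_zero hψ hρ hy, mul_zero]]
    simp_rw [sub_mul]
    rw [integral_sub hur (hr.const_mul a), integral_const_mul, integral_rescale hψ z hρ, mul_one]
    unfold smoothAverage
    rw [← integral_indicator hW]
    simp_rw [indicator_mul_left]
  have h2 : IntegrableOn (fun y => ‖W.indicator u y - a‖) (Metric.closedBall z ρ) := by
    refine (hu'.integrableOn.sub ?_).norm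
    exact integrableOn_const measure_closedBall_lt_top.ne
  rw [h1, ← Real.norm_eq_abs]
  refine (norm_integral_le_of_norm_le (h2.const_mul ((ρ ^ d)⁻¹ * M)) ?_).trans ?_
  · filter_upwards with y
    rw [norm_mul, mul_comm]
    gcongr
    exact norm_rescale_le hM z y hρ
  · rw [integral_const_mul, setAverage_eq, volume_real_closedBall z hρ, smul_eq_mul, mul_inv]
    have hκ : volume.real (Metric.ball (0 : EuclideanSpace ℝ (Fin d)) 1) ≠ 0 :=
      (ENNReal.toReal_pos (Metric.measure_ball_pos _ _ one_pos).ne' measure_ball_lt_top.ne).ne'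
    apply le_of_eq
    field_simp

/-- Lebesgue differentiation for smooth averages over balls that are not centred. -/
theorem ae_tendsto_smoothAverage (hψ : IsAveragingKernel ψ) (hu : IntegrableOn u W)
    (hW : MeasurableSet W) (C : ℝ) :
    ∀ᵐ x, x ∈ W → ∀ (z : ℕ → EuclideanSpace ℝ (Fin d)) (ρ : ℕ → ℝ), (∀ k, 0 < ρ k) →
      Tendsto ρ atTop (𝓝 0) → (∀ k, x ∈ Metric.closedBall (z k) (C * ρ k)) →
      Tendsto (fun k => smoothAverage W ψ u (z k) (ρ k)) atTop (𝓝 (u x)) := by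
  obtain ⟨M, hM0, hM⟩ := hψ.exists_bound
  have hu' : Integrable (W.indicator u) := hu.integrable_indicator hW
  filter_upwards [IsUnifLocDoublingMeasure.ae_tendsto_average_norm_sub volume
    hu'.locallyIntegrable C] with x hx hxW z ρ hρ0 hρ hxz
  have h1 := hx z ρ (tendsto_nhdsWithin_iff.mpr ⟨hρ, Eventually.of_forall hρ0⟩)
    (Eventually.of_forall hxz)
  have h2 := h1.const_mul
    (M * volume.real (Metric.ball (0 : EuclideanSpace ℝ (Fin d)) 1))
  rw [mul_zero, indicator_of_mem hxW] at h2
  rw [tendsto_iff_norm_sub_tendsto_zero]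
  refine squeeze_zero (fun _ => norm_nonneg _) (fun k => ?_) h2
  exact abs_smoothAverage_sub_le_average hM hψ hu hW (u x) (z k) (hρ0 k)

/-- Pointwise control of the oscillation of `u` at boundary scale by averages of the gradient
over dyadic balls. -/
theorem exists_edist_le_tsum_laverage (d : ℕ) : ∃ A : ℝ, 0 < A ∧
    ∀ {Ω : Set (EuclideanSpace ℝ (Fin d))} {R₀ : ℝ}, IsOpen Ω →
    (∀ p ∈ frontier Ω, ∀ s, 0 < s → s ≤ R₀ → ∃ n, FlatAt Ω p s n) →
    ∀ {x₀ : EuclideanSpace ℝ (Fin d)}, x₀ ∈ frontier Ω → ∀ {R : ℝ}, 0 < R → 2 * R ≤ R₀ →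
    ∀ {u : EuclideanSpace ℝ (Fin d) → ℝ}
      {Du : EuclideanSpace ℝ (Fin d) → EuclideanSpace ℝ (Fin d)},
    IntegrableOn u (Ω ∩ Metric.ball x₀ (2 * R)) → IntegrableOn Du (Ω ∩ Metric.ball x₀ (2 * R)) →
    (∀ i, HasWeakPartialDeriv (Ω ∩ Metric.ball x₀ (2 * R)) i u (fun x => Du x i)) →
    ∃ c : ℝ, ∀ᵐ x, x ∈ Ω ∩ Metric.ball x₀ R →
      edist c (u x) ≤ ∑' k : ℕ, ENNReal.ofReal A * (ENNReal.ofReal (R / 2 ^ k) *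
        ⨍⁻ y in Metric.closedBall x (3 * (R / 2 ^ k)),
          (Ω ∩ Metric.ball x₀ (2 * R)).indicator (fun y => ‖Du y‖ₑ) y ∂volume) := by
  obtain ⟨ψ, hψ⟩ := exists_isAveragingKernel d
  obtain ⟨M, hM0, hM⟩ := hψ.exists_bound
  set κ := volume.real (Metric.ball (0 : EuclideanSpace ℝ (Fin d)) 1) with hκ_def
  have hκ : 0 < κ :=
    ENNReal.toReal_pos (Metric.measure_ball_pos _ _ one_pos).ne' measure_ball_lt_top.ne
  -- The 7 bounds centre displacement (6r) plus radius change (at most r); 32^d comes from the lower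
  -- bound r/32 on the radii; 3^d κ turns the integral over the ball of radius 3r into an average.
  refine ⟨7 * 32 ^ d * 3 ^ d * κ * M, by positivity, ?_⟩
  intro Ω R₀ hΩ hflat x₀ hx₀ R hR hRR₀ u Du hu hDu hweak
  obtain ⟨z₀, hz₀⟩ := exists_chain hΩ hflat hx₀ hR hRR₀
  set W := Ω ∩ Metric.ball x₀ (2 * R) with hWdef
  have hW : MeasurableSet W := (hΩ.inter Metric.isOpen_ball).measurableSet
  refine ⟨smoothAverage W ψ u z₀ (R / 16), ?_⟩
  -- 48 = 3 · 16: the centres are within 3r of x while the radii are r/16.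
  filter_upwards [ae_tendsto_smoothAverage hψ hu hW 48] with x hx hxR
  have hxW : x ∈ W := ⟨hxR.1, Metric.ball_subset_ball (by linarith) hxR.2⟩
  obtain ⟨z, hz0, hz⟩ := hz₀ x hxR
  choose K hKc hKW hKB hzK hzK' using hz
  have hρ : ∀ k : ℕ, 0 < R / 2 ^ k / 16 := fun k => by positivity
  have hzx : ∀ k, z k ∈ Metric.closedBall x (3 * (R / 2 ^ k)) := fun k =>
    hKB k (hzK k (Metric.mem_ball_self (hρ k)))
  have hzx' : ∀ k, z (k + 1) ∈ Metric.closedBall x (3 * (R / 2 ^ k)) := fun k =>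
    hKB k (hzK' k (Metric.mem_ball_self (hρ (k + 1))))
  have hlim := hx hxW z (fun k => R / 2 ^ k / 16) hρ ?_ ?_
  · have h0 : smoothAverage W ψ u z₀ (R / 16) = smoothAverage W ψ u (z 0) (R / 2 ^ 0 / 16) := by
      rw [hz0, pow_zero, div_one]
    rw [h0]
    refine edist_le_tsum_of_edist_le_of_tendsto₀ _ (fun k => ?_) hlim
    set r := R / 2 ^ k with hr
    have hr0 : 0 < r := by positivity
    have hr' : R / 2 ^ (k + 1) = r / 2 := by rw [hr, pow_succ]; field_simp
    have hzz : ‖z (k + 1) - z k‖ ≤ 6 * r := by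
      have h1 := hzx k
      have h2 := hzx' k
      rw [Metric.mem_closedBall] at h1 h2
      rw [← dist_eq_norm]
      linarith [dist_triangle_right (z (k + 1)) (z k) x]
    set B := Metric.closedBall x (3 * r) with hB
    have key := abs_smoothAverage_sub_le hM0.le hM hψ hweak hu hDu
      (B := B) Metric.isClosed_closedBall.measurableSet (hKc k) (hKW k) (hKB k)
      (z := z k) (z' := z (k + 1)) (ρ := r / 16) (ρ' := r / 2 / 16) (σ := r / 32)
      (by positivity) (by linarith) (by linarith) (hzK k) (by rw [← hr']; exact hzK' k)
    have hJ : ∫⁻ y in B, W.indicator (fun y => ‖Du y‖ₑ) y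
        = ENNReal.ofReal (∫ y in W ∩ B, ‖Du y‖) := by
      rw [ofReal_integral_norm_eq_lintegral_enorm (hDu.mono_set inter_subset_left),
        setLIntegral_indicator hW]
    have hI : 0 ≤ ∫ y in W ∩ B, ‖Du y‖ := integral_nonneg fun _ => norm_nonneg _
    have hvol : volume B = ENNReal.ofReal ((3 * r) ^ d * κ) := by
      rw [hκ_def, ← volume_real_closedBall x (by positivity), hB,
        ofReal_measureReal measure_closedBall_lt_top.ne]
    change edist (smoothAverage W ψ u (z k) (R / 2 ^ k / 16))
      (smoothAverage W ψ u (z (k + 1)) (R / 2 ^ (k + 1) / 16)) ≤ _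
    rw [setLAverage_eq, hJ, hvol, ← ENNReal.ofReal_div_of_pos (by positivity),
      ← ENNReal.ofReal_mul hr0.le, ← ENNReal.ofReal_mul (by positivity), edist_comm, edist_dist,
      Real.dist_eq, hr', ← hr]
    refine ENNReal.ofReal_le_ofReal (key.trans ?_)
    have h3 : |r / 2 / 16 - r / 16| ≤ r := by
      rw [abs_le]; constructor <;> linarith
    calc ((r / 32) ^ d)⁻¹ * (M * (‖z (k + 1) - z k‖ + |r / 2 / 16 - r / 16|) *
          ∫ y in W ∩ B, ‖Du y‖)
        ≤ ((r / 32) ^ d)⁻¹ * (M * (6 * r + r) * ∫ y in W ∩ B, ‖Du y‖) := by gcongr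
      _ = _ := by
        rw [div_pow, mul_pow]
        field_simp
        ring
  · have h1 : Tendsto (fun k : ℕ => R * (1 / 2 : ℝ) ^ k / 16) atTop (𝓝 (R * 0 / 16)) :=
      ((_root_.tendsto_pow_atTop_nhds_zero_of_lt_one (by norm_num) (by norm_num)).const_mul R).div_const _
    simpa [div_eq_mul_inv] using h1
  · intro k
    have h1 := hzx k
    rw [Metric.mem_closedBall] at h1 ⊢
    rw [dist_comm]
    linarith

end Pointwise

/-! ### The Hardy–Littlewood maximal theorem -/

section Maximal

open ENNReal

/-- Layer-cake formula for powers of an extended nonnegative real. -/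
theorem lintegral_rpow_sub_one_indicator {p : ℝ} (hp : 0 < p) (a : ℝ≥0∞) :
    ∫⁻ t in Ioi (0 : ℝ), (if ENNReal.ofReal t < a then ENNReal.ofReal (t ^ (p - 1)) else 0)
      = a ^ p / ENNReal.ofReal p := by
  have hfin : ∀ b : ℝ, 0 < b →
      ∫⁻ t in Ioo (0 : ℝ) b, ENNReal.ofReal (t ^ (p - 1)) = ENNReal.ofReal (b ^ p / p) := by
    intro b hb
    have hint : IntegrableOn (fun t : ℝ => t ^ (p - 1)) (Ioc 0 b) :=
      (intervalIntegrable_iff_integrableOn_Ioc_of_le hb.le).mp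
        (intervalIntegral.intervalIntegrable_rpow' (by linarith))
    rw [restrict_Ioo_eq_restrict_Ioc, ← ofReal_integral_eq_lintegral_ofReal hint,
      ← intervalIntegral.integral_of_le hb.le, integral_rpow (Or.inl (by linarith)),
      sub_add_cancel, Real.zero_rpow hp.ne', sub_zero]
    filter_upwards [ae_restrict_mem measurableSet_Ioc] with t ht
    exact Real.rpow_nonneg ht.1.le _
  have hreal : ∀ b : ℝ, 0 < b →
      ∫⁻ t in Ioi (0 : ℝ), (if ENNReal.ofReal t < ENNReal.ofReal b then
        ENNReal.ofReal (t ^ (p - 1)) else 0) = ENNReal.ofReal b ^ p / ENNReal.ofReal p := by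
    intro b hb
    have h1 : ∀ t : ℝ, (if ENNReal.ofReal t < ENNReal.ofReal b then
        ENNReal.ofReal (t ^ (p - 1)) else 0)
        = (Iio b).indicator (fun t => ENNReal.ofReal (t ^ (p - 1))) t := by
      intro t
      simp only [indicator_apply, mem_Iio, ENNReal.ofReal_lt_ofReal_iff hb]
    simp_rw [h1]
    rw [setLIntegral_indicator measurableSet_Iio, inter_comm, Ioi_inter_Iio, hfin b hb,
      ENNReal.ofReal_rpow_of_pos hb, ENNReal.ofReal_div_of_pos hp]
  -- For a = ∞ the integral exceeds every truncated value b^p/p, which tends to infinity.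
  rcases eq_or_ne a ∞ with rfl | ha
  · rw [ENNReal.top_rpow_of_pos hp, ENNReal.top_div_of_ne_top ENNReal.ofReal_ne_top, eq_top_iff]
    have hlim : Filter.Tendsto (fun b : ℝ => ENNReal.ofReal (b ^ p / p)) Filter.atTop
        (nhds ∞) :=
      ENNReal.tendsto_ofReal_atTop.comp ((tendsto_rpow_atTop hp).atTop_div_const hp)
    refine le_of_tendsto hlim ?_
    filter_upwards [Filter.eventually_gt_atTop 0] with b hb
    rw [← hfin b hb]
    refine (lintegral_mono_set Ioo_subset_Ioi_self).trans (lintegral_mono fun t => ?_)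
    simp
  · rcases eq_or_ne a 0 with rfl | ha0
    · simp [ENNReal.zero_rpow_of_pos hp]
    · have := hreal a.toReal (ENNReal.toReal_pos ha0 ha)
      rwa [ENNReal.ofReal_toReal ha] at this

variable {E : Type*} [NormedAddCommGroup E] [NormedSpace ℝ E] [FiniteDimensional ℝ E]
  [MeasurableSpace E] [BorelSpace E] (μ : Measure E) [μ.IsAddHaarMeasure]

/-- The centred maximal function over the radii `r k`. -/
noncomputable def maximalFunction (r : ℕ → ℝ) (f : E → ℝ≥0∞) (x : E) : ℝ≥0∞ :=
  ⨆ k, ⨍⁻ y in Metric.closedBall x (r k), f y ∂μ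

/-- The volume of the ball does not depend on its centre, so the average is a parameter integral
over the closed relation dist ≤ r, divided by a constant. -/
theorem measurable_laverage_closedBall (r : ℝ) {f : E → ℝ≥0∞} (hf : Measurable f) :
    Measurable fun x => ⨍⁻ y in Metric.closedBall x r, f y ∂μ := by
  have h1 : (fun x => ⨍⁻ y in Metric.closedBall x r, f y ∂μ)
      = fun x => (∫⁻ y, {p : E × E | dist p.2 p.1 ≤ r}.indicator (fun p => f p.2) (x, y) ∂μ)
        / μ (Metric.closedBall (0 : E) r) := by
    ext x
    rw [setLAverage_eq, Measure.addHaar_closedBall_center,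
      ← lintegral_indicator Metric.isClosed_closedBall.measurableSet]
    rfl
  rw [h1]
  refine Measurable.div_const (Measurable.lintegral_prod_right' ?_) _
  refine (hf.comp measurable_snd).indicator ?_
  exact (isClosed_le (by fun_prop) continuous_const).measurableSet

theorem measurable_maximalFunction (r : ℕ → ℝ) {f : E → ℝ≥0∞} (hf : Measurable f) :
    Measurable (maximalFunction μ r f) :=
  Measurable.iSup fun k => measurable_laverage_closedBall μ (r k) hf

/-- Weak type `(1, 1)` estimate for the maximal function. -/
theorem mul_measure_maximalFunction_le {r : ℕ → ℝ} (hr : ∀ k, 0 < r k) {P : ℝ}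
    (hP : ∀ k, r k ≤ P) (f : E → ℝ≥0∞) (t : ℝ≥0∞) :
    t * μ {x | t < maximalFunction μ r f x}
      ≤ 4 ^ Module.finrank ℝ E * ∫⁻ y, f y ∂μ := by
  set S := {x | t < maximalFunction μ r f x}
  have hS : ∀ x : E, ∃ k, x ∈ S → t < ⨍⁻ y in Metric.closedBall x (r k), f y ∂μ := by
    intro x
    by_cases hx : x ∈ S
    · obtain ⟨k, hk⟩ := lt_iSup_iff.mp (show t < maximalFunction μ r f x from hx)
      exact ⟨k, fun _ => hk⟩
    · exact ⟨0, fun h => absurd h hx⟩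
  choose k hk using hS
  -- Vitali's lemma needs the uniform bound P on the radii and an enlargement factor greater than 3;
  -- the choice 4 is the source of the constant 4^dim.
  obtain ⟨v, hvS, hdisj, hcov⟩ := Vitali.exists_disjoint_subfamily_covering_enlargement_closedBall
    S id (fun x => r (k x)) P (fun x _ => hP _) 4 (by norm_num)
  simp only [id_eq] at hdisj hcov
  have hvc : v.Countable := by
    refine hdisj.countable_of_nonempty_interior fun x _ => ?_
    exact ⟨x, Metric.ball_subset_interior_closedBall (Metric.mem_ball_self (hr _))⟩
  have hball : ∀ x ∈ v, t * μ (Metric.closedBall x (4 * r (k x)))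
      ≤ 4 ^ Module.finrank ℝ E * ∫⁻ y in Metric.closedBall x (r (k x)), f y ∂μ := by
    intro x hx
    have h1 := (hk x (hvS hx)).le
    rw [setLAverage_eq, ENNReal.le_div_iff_mul_le
      (Or.inl (Metric.measure_closedBall_pos μ _ (hr _)).ne')
      (Or.inl measure_closedBall_lt_top.ne)] at h1
    rw [Measure.addHaar_closedBall_mul μ x (by norm_num) (hr _).le,
      Measure.addHaar_closedBall_center μ x] at *
    calc t * (ENNReal.ofReal (4 ^ Module.finrank ℝ E) * μ (Metric.closedBall 0 (r (k x))))
        = ENNReal.ofReal (4 ^ Module.finrank ℝ E) *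
          (t * μ (Metric.closedBall 0 (r (k x)))) := by ring
      _ ≤ ENNReal.ofReal (4 ^ Module.finrank ℝ E) *
          ∫⁻ y in Metric.closedBall x (r (k x)), f y ∂μ := by gcongr
      _ = _ := by rw [ENNReal.ofReal_pow (by norm_num)]; simp
  have hcov' : S ⊆ ⋃ x ∈ v, Metric.closedBall x (4 * r (k x)) := by
    intro x hx
    obtain ⟨b, hb, hxb⟩ := hcov x hx
    exact mem_biUnion hb (hxb (Metric.mem_closedBall_self (hr _).le))
  calc t * μ S ≤ t * ∑' x : v, μ (Metric.closedBall (x : E) (4 * r (k x))) := by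
        gcongr
        exact (measure_mono hcov').trans (measure_biUnion_le μ hvc _)
    _ = ∑' x : v, t * μ (Metric.closedBall (x : E) (4 * r (k x))) := ENNReal.tsum_mul_left.symm
    _ ≤ ∑' x : v, 4 ^ Module.finrank ℝ E *
        ∫⁻ y in Metric.closedBall (x : E) (r (k x)), f y ∂μ :=
      ENNReal.tsum_le_tsum fun x => hball x x.2
    _ = 4 ^ Module.finrank ℝ E * ∫⁻ y in ⋃ x ∈ v, Metric.closedBall x (r (k x)), f y ∂μ := by
      rw [ENNReal.tsum_mul_left, lintegral_biUnion hvc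
        (fun x _ => Metric.isClosed_closedBall.measurableSet) hdisj]
    _ ≤ _ := by
      gcongr
      exact Measure.restrict_le_self

/-- The part of f not exceeding t/2 contributes at most t/2 to any average, so the truncation g must
have maximal function above t/2; the weak type bound is applied to g at that level. -/
theorem mul_measure_maximalFunction_le_truncated {r : ℕ → ℝ} (hr : ∀ k, 0 < r k) {P : ℝ}
    (hP : ∀ k, r k ≤ P) {f : E → ℝ≥0∞} (hf : Measurable f) (t : ℝ≥0∞) :
    t * μ {x | t < maximalFunction μ r f x}
      ≤ 2 * 4 ^ Module.finrank ℝ E * ∫⁻ y, (if t < 2 * f y then f y else 0) ∂μ := by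
  set g : E → ℝ≥0∞ := fun y => if t < 2 * f y then f y else 0
  have hg : Measurable g :=
    Measurable.ite (measurableSet_lt measurable_const (hf.const_mul 2)) hf measurable_const
  have hfg : ∀ y, f y ≤ g y + t / 2 := by
    intro y
    by_cases h : t < 2 * f y
    · simp [g, h]
    · simp only [g, h, if_false, zero_add]
      rw [ENNReal.le_div_iff_mul_le (by simp) (by simp), mul_comm]
      exact not_lt.mp h
  have hsub : {x | t < maximalFunction μ r f x} ⊆ {x | t / 2 < maximalFunction μ r g x} := by
    intro x hx
    obtain ⟨k, hk⟩ := lt_iSup_iff.mp (show t < maximalFunction μ r f x from hx)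
    refine lt_of_lt_of_le (b := ⨍⁻ y in Metric.closedBall x (r k), g y ∂μ) ?_
      (le_iSup (fun k => ⨍⁻ y in Metric.closedBall x (r k), g y ∂μ) k)
    by_contra! hle
    have h1 : ⨍⁻ y in Metric.closedBall x (r k), f y ∂μ
        ≤ (⨍⁻ y in Metric.closedBall x (r k), g y ∂μ) + t / 2 := by
      rw [setLAverage_eq, setLAverage_eq]
      calc (∫⁻ y in Metric.closedBall x (r k), f y ∂μ) / μ (Metric.closedBall x (r k))
          ≤ (∫⁻ y in Metric.closedBall x (r k), (g y + t / 2) ∂μ)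
            / μ (Metric.closedBall x (r k)) := by gcongr with y; exact hfg y
        _ = _ := by
          rw [lintegral_add_left hg, setLIntegral_const, ENNReal.add_div,
            ENNReal.mul_div_cancel_right (Metric.measure_closedBall_pos μ _ (hr _)).ne'
              measure_closedBall_lt_top.ne]
    refine absurd hk (not_lt.mpr (h1.trans ?_))
    calc _ ≤ t / 2 + t / 2 := by gcongr
      _ = t := ENNReal.add_halves t
  have h2 := mul_measure_maximalFunction_le μ hr hP g (t / 2)
  calc t * μ {x | t < maximalFunction μ r f x}
      ≤ t * μ {x | t / 2 < maximalFunction μ r g x} := by gcongr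
    _ = 2 * (t / 2 * μ {x | t / 2 < maximalFunction μ r g x}) := by
      rw [← mul_assoc, ENNReal.mul_div_cancel (by simp) (by simp)]
    _ ≤ 2 * (4 ^ Module.finrank ℝ E * ∫⁻ y, g y ∂μ) := by gcongr
    _ = _ := by ring

/-- Strong type `(q, q)` estimate for the maximal function, `1 < q`. -/
theorem lintegral_maximalFunction_rpow_le {q : ℝ} (hq : 1 < q) {r : ℕ → ℝ} (hr : ∀ k, 0 < r k)
    {P : ℝ} (hP : ∀ k, r k ≤ P) {f : E → ℝ≥0∞} (hf : Measurable f) :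
    ∫⁻ x, maximalFunction μ r f x ^ q ∂μ
      ≤ ENNReal.ofReal q * (2 * 4 ^ Module.finrank ℝ E) * (2 ^ (q - 1) / ENNReal.ofReal (q - 1)) *
        ∫⁻ x, f x ^ q ∂μ := by
  set m := maximalFunction μ r f
  have hm : Measurable m := measurable_maximalFunction μ r hf
  set C : ℝ≥0∞ := 2 * 4 ^ Module.finrank ℝ E
  have hq0 : ENNReal.ofReal q ≠ 0 := by simp; linarith
  have hmeas : ∀ (p : ℝ) (g : E → ℝ≥0∞), Measurable g →
      Measurable (fun z : E × ℝ =>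
        if ENNReal.ofReal z.2 < g z.1 then ENNReal.ofReal (z.2 ^ (p - 1)) else 0) := by
    intro p g hg
    refine Measurable.ite (measurableSet_lt (by fun_prop) (by fun_prop)) ?_ measurable_const
    fun_prop
  have h1 : ∀ a : ℝ≥0∞, a ^ q = ENNReal.ofReal q * ∫⁻ t in Ioi (0 : ℝ),
      (if ENNReal.ofReal t < a then ENNReal.ofReal (t ^ (q - 1)) else 0) := by
    intro a
    rw [lintegral_rpow_sub_one_indicator (by linarith),
      ENNReal.mul_div_cancel hq0 ENNReal.ofReal_ne_top]
  have h2 : ∀ t ∈ Ioi (0 : ℝ),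
      ∫⁻ x, (if ENNReal.ofReal t < m x then ENNReal.ofReal (t ^ (q - 1)) else 0) ∂μ
        ≤ C * ∫⁻ x, f x * (if ENNReal.ofReal t < 2 * f x then
          ENNReal.ofReal (t ^ (q - 1 - 1)) else 0) ∂μ := by
    intro t ht
    have ht0 : (0 : ℝ) < t := ht
    have e1 : ∫⁻ x, (if ENNReal.ofReal t < m x then ENNReal.ofReal (t ^ (q - 1)) else 0) ∂μ
        = ENNReal.ofReal (t ^ (q - 1)) * μ {x | ENNReal.ofReal t < m x} := by
      rw [← lintegral_indicator_const (measurableSet_lt measurable_const hm)]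
      refine lintegral_congr fun x => ?_
      simp only [indicator_apply, mem_ofPred_eq]
    -- One factor t is split off for the weak type bound; the remaining power t^(q-2) is integrable
    -- at 0 because q > 1.
    have e2 : ENNReal.ofReal (t ^ (q - 1)) = ENNReal.ofReal (t ^ (q - 1 - 1)) * ENNReal.ofReal t := by
      rw [← ENNReal.ofReal_mul (by positivity), ← Real.rpow_add_one ht0.ne', sub_add_cancel]
    rw [e1, e2, mul_assoc]
    refine (mul_le_mul_right (mul_measure_maximalFunction_le_truncated μ hr hP hf
      (ENNReal.ofReal t)) _).trans (le_of_eq ?_)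
    rw [mul_left_comm, ← lintegral_const_mul']
    · congr 1
      refine lintegral_congr fun x => ?_
      split_ifs <;> ring
    · exact ENNReal.ofReal_ne_top
  calc ∫⁻ x, m x ^ q ∂μ
      = ENNReal.ofReal q * ∫⁻ x, (∫⁻ t in Ioi (0 : ℝ),
        (if ENNReal.ofReal t < m x then ENNReal.ofReal (t ^ (q - 1)) else 0)) ∂μ := by
        simp_rw [h1]
        rw [lintegral_const_mul' _ _ ENNReal.ofReal_ne_top]
    _ = ENNReal.ofReal q * ∫⁻ t in Ioi (0 : ℝ), (∫⁻ x,
        (if ENNReal.ofReal t < m x then ENNReal.ofReal (t ^ (q - 1)) else 0) ∂μ) := by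
        rw [lintegral_lintegral_swap (hmeas q m hm).aemeasurable]
    _ ≤ ENNReal.ofReal q * ∫⁻ t in Ioi (0 : ℝ), C * (∫⁻ x, f x *
        (if ENNReal.ofReal t < 2 * f x then ENNReal.ofReal (t ^ (q - 1 - 1)) else 0) ∂μ) := by
        gcongr ENNReal.ofReal q * ?_
        exact setLIntegral_mono' measurableSet_Ioi h2
    _ = ENNReal.ofReal q * (C * ∫⁻ x, (∫⁻ t in Ioi (0 : ℝ), f x *
        (if ENNReal.ofReal t < 2 * f x then ENNReal.ofReal (t ^ (q - 1 - 1)) else 0)) ∂μ) := by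
        rw [lintegral_const_mul' _ _ (by finiteness), ← lintegral_lintegral_swap]
        exact ((hf.comp measurable_fst).mul (hmeas (q - 1) _ (hf.const_mul 2))).aemeasurable
    _ = ENNReal.ofReal q * (C * ∫⁻ x,
        (2 ^ (q - 1) / ENNReal.ofReal (q - 1)) * f x ^ q ∂μ) := by
        congr 2
        refine lintegral_congr fun x => ?_
        rw [lintegral_const_mul, lintegral_rpow_sub_one_indicator (by linarith),
          ENNReal.mul_rpow_of_nonneg _ _ (by linarith)]
        · have h3 : f x ^ q = f x * f x ^ (q - 1) := by
            conv_lhs => rw [← add_sub_cancel 1 q, ENNReal.rpow_add_of_nonneg _ _ (by norm_num)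
              (by linarith), ENNReal.rpow_one]
          rw [h3, div_eq_mul_inv, div_eq_mul_inv]
          ring
        · exact (hmeas (q - 1) _ (hf.const_mul 2)).comp measurable_prodMk_left
    _ = _ := by
        rw [lintegral_const_mul _ (by fun_prop)]
        ring

end Maximal

/-! ### Hedberg's argument and the Hardy–Littlewood–Sobolev inequality -/

section Potential

open ENNReal

/-- Writing s = 2^σ and shifting the index by ⌊σ⌋ bounds the sum by a part of one fixed series over
ℤ, geometric in both directions; hence the uniformity in s. -/
theorem exists_tsum_min_rpow_le {β : ℝ} (hβ : 0 < β) : ∃ C : ℝ≥0∞, C ≠ ⊤ ∧ ∀ s : ℝ, 0 < s →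
    ∑' k : ℕ, ENNReal.ofReal (min (s / 2 ^ k) ((s / 2 ^ k) ^ (-β))) ≤ C := by
  set g : ℤ → ℝ := fun j => min ((2 : ℝ) ^ (1 - (j : ℝ))) ((2 : ℝ) ^ (β * j)) with hg
  have hg0 : ∀ j, 0 ≤ g j := fun j => by positivity
  have hsum : Summable g := by
    refine Summable.of_nat_of_neg ?_ ?_
    · refine Summable.of_nonneg_of_le (fun n => hg0 _) (fun n => min_le_left _ _) ?_
      have h1 : ∀ n : ℕ, (2 : ℝ) ^ (1 - ((n : ℤ) : ℝ)) = 2 * (1 / 2) ^ n := by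
        intro n
        rw [Real.rpow_sub two_pos, Real.rpow_one, Int.cast_natCast, Real.rpow_natCast]
        simp [div_eq_mul_inv]
      simp_rw [h1]
      exact summable_geometric_two.mul_left 2
    · refine Summable.of_nonneg_of_le (fun n => hg0 _) (fun n => min_le_right _ _) ?_
      have h1 : ∀ n : ℕ, (2 : ℝ) ^ (β * ((-(n : ℤ) : ℤ) : ℝ)) = ((2 : ℝ) ^ (-β)) ^ n := by
        intro n
        rw [← Real.rpow_natCast, ← Real.rpow_mul two_pos.le]
        push_cast
        ring_nf
      simp_rw [h1]
      exact summable_geometric_of_lt_one (by positivity)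
        (Real.rpow_lt_one_of_one_lt_of_neg one_lt_two (by linarith))
  refine ⟨∑' j : ℤ, ENNReal.ofReal (g j), hsum.tsum_ofReal_ne_top, fun s hs => ?_⟩
  set σ := Real.logb 2 s
  have hsσ : s = 2 ^ σ := (Real.rpow_logb two_pos (by norm_num) hs).symm
  have hterm : ∀ k : ℕ, min (s / 2 ^ k) ((s / 2 ^ k) ^ (-β)) ≤ g ((k : ℤ) - ⌊σ⌋) := by
    intro k
    have h1 : s / 2 ^ k = (2 : ℝ) ^ (σ - k) := by
      rw [Real.rpow_sub two_pos, ← hsσ, Real.rpow_natCast]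
    rw [h1, ← Real.rpow_mul two_pos.le]
    have h2 := Int.floor_le σ
    have h3 := Int.lt_floor_add_one σ
    refine min_le_min ?_ ?_ <;> refine Real.rpow_le_rpow_of_exponent_le one_le_two ?_
    · push_cast
      linarith
    · push_cast
      nlinarith
  calc ∑' k : ℕ, ENNReal.ofReal (min (s / 2 ^ k) ((s / 2 ^ k) ^ (-β)))
      ≤ ∑' k : ℕ, ENNReal.ofReal (g ((k : ℤ) - ⌊σ⌋)) :=
        ENNReal.tsum_le_tsum fun k => ENNReal.ofReal_le_ofReal (hterm k)
    _ ≤ _ := ENNReal.tsum_comp_le_tsum_of_injective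
        (f := fun k : ℕ => (k : ℤ) - ⌊σ⌋) (fun a b hab => by simpa using hab)
        (fun j => ENNReal.ofReal (g j))

/-- Hedberg's interpolation of a dyadic sum. -/
theorem exists_tsum_le_rpow_mul_rpow {β : ℝ} (hβ : 0 < β) : ∃ C : ℝ≥0∞, C ≠ ⊤ ∧
    ∀ R : ℝ, 0 < R → ∀ (m A : ℝ≥0∞) (b : ℕ → ℝ≥0∞),
    (∀ k, b k ≤ ENNReal.ofReal (R / 2 ^ k) * m) →
    (∀ k, b k ≤ ENNReal.ofReal ((R / 2 ^ k) ^ (-β)) * A) →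
    ∑' k, b k ≤ C * (m ^ (β / (1 + β)) * A ^ (1 / (1 + β))) := by
  obtain ⟨C, hC, hsum⟩ := exists_tsum_min_rpow_le hβ
  have hp1 : 0 < β / (1 + β) := by positivity
  have hp2 : 0 < 1 / (1 + β) := by positivity
  -- The added 1 makes the constant nonzero, so that its product with ∞ is ∞ in the degenerate
  -- cases.
  refine ⟨C + 1, by finiteness, fun R hR m A b h1 h2 => ?_⟩
  have hC1 : C + 1 ≠ 0 := by simp
  by_cases hm0 : m = 0
  · have : ∀ k, b k = 0 := fun k => by simpa [hm0] using h1 k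
    simp [this]
  by_cases hA0 : A = 0
  · have : ∀ k, b k = 0 := fun k => by simpa [hA0] using h2 k
    simp [this]
  by_cases hmt : m = ⊤
  · rw [hmt, ENNReal.top_rpow_of_pos hp1, ENNReal.top_mul, ENNReal.mul_top hC1]
    · exact le_top
    · exact fun h => hA0 ((ENNReal.rpow_eq_zero_iff_of_pos hp2).mp h)
  by_cases hAt : A = ⊤
  · rw [hAt, ENNReal.top_rpow_of_pos hp2, ENNReal.mul_top, ENNReal.mul_top hC1]
    · exact le_top
    · exact fun h => hm0 ((ENNReal.rpow_eq_zero_iff_of_pos hp1).mp h)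
  obtain ⟨m', hm', rfl⟩ : ∃ m' : ℝ, 0 < m' ∧ m = ENNReal.ofReal m' :=
    ⟨m.toReal, ENNReal.toReal_pos hm0 hmt, (ENNReal.ofReal_toReal hmt).symm⟩
  obtain ⟨a, ha, rfl⟩ : ∃ a : ℝ, 0 < a ∧ A = ENNReal.ofReal a :=
    ⟨A.toReal, ENNReal.toReal_pos hA0 hAt, (ENNReal.ofReal_toReal hAt).symm⟩
  -- ρ is the crossover scale at which the two bounds ρm' and ρ^(-β)a coincide; their common value
  -- is the interpolated product.
  set ρ := (a / m') ^ (1 / (1 + β)) with hρ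
  have hρ0 : 0 < ρ := by positivity
  have hρm : ρ * m' = m' ^ (β / (1 + β)) * a ^ (1 / (1 + β)) := by
    rw [hρ, Real.div_rpow ha.le hm'.le]
    have : m' = m' ^ (β / (1 + β)) * m' ^ (1 / (1 + β)) := by
      rw [← Real.rpow_add hm', ← add_div, add_comm β 1, div_self (by positivity), Real.rpow_one]
    have h3 : 0 < m' ^ (1 / (1 + β)) := by positivity
    rw [div_mul_eq_mul_div, div_eq_iff h3.ne', mul_right_comm, ← this, mul_comm]
  have hρa : ρ ^ (-β) * a = ρ * m' := by
    have h4 : ρ ^ (1 + β) = a / m' := by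
      rw [hρ, ← Real.rpow_mul (by positivity), one_div_mul_cancel (by positivity), Real.rpow_one]
    rw [Real.rpow_add hρ0, Real.rpow_one] at h4
    rw [Real.rpow_neg hρ0.le]
    have h5 : 0 < ρ ^ β := by positivity
    field_simp at h4 ⊢
    linarith
  have hb : ∀ k, b k ≤ ENNReal.ofReal (min (R / ρ / 2 ^ k) ((R / ρ / 2 ^ k) ^ (-β))) *
      ENNReal.ofReal (ρ * m') := by
    intro k
    rw [← ENNReal.ofReal_mul (by positivity), min_mul_of_nonneg _ _ (by positivity),
      ENNReal.ofReal_min]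
    refine le_min ((h1 k).trans (le_of_eq ?_)) ((h2 k).trans (le_of_eq ?_))
    · rw [← ENNReal.ofReal_mul (by positivity)]
      congr 1
      field_simp
    · rw [← ENNReal.ofReal_mul (by positivity), ← hρa, ← mul_assoc,
        ← Real.mul_rpow (by positivity) (by positivity)]
      congr 3
      field_simp
  calc ∑' k, b k ≤ ∑' k : ℕ, ENNReal.ofReal (min (R / ρ / 2 ^ k) ((R / ρ / 2 ^ k) ^ (-β))) *
        ENNReal.ofReal (ρ * m') := ENNReal.tsum_le_tsum hb
    _ ≤ (C + 1) * ENNReal.ofReal (ρ * m') := by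
        rw [ENNReal.tsum_mul_right]
        gcongr
        exact (hsum _ (by positivity)).trans le_self_add
    _ = _ := by
        rw [hρm, ENNReal.ofReal_mul (by positivity), ENNReal.ofReal_rpow_of_pos hm',
          ENNReal.ofReal_rpow_of_pos ha]

variable {d : ℕ}

theorem setLAverage_closedBall_le {q : ℝ} (hq : 1 < q) {f : EuclideanSpace ℝ (Fin d) → ℝ≥0∞}
    (hf : Measurable f) (x : EuclideanSpace ℝ (Fin d)) {r : ℝ} (hr : 0 < r) :
    ⨍⁻ y in Metric.closedBall x r, f y ∂volume ≤
      volume (Metric.closedBall x r) ^ (-(1 / q)) * (∫⁻ y, f y ^ q) ^ (1 / q) := by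
  set B := Metric.closedBall x r
  have hB0 : volume B ≠ 0 := (Metric.measure_closedBall_pos volume _ hr).ne'
  have hBt : volume B ≠ ⊤ := measure_closedBall_lt_top.ne
  have hpq : q.HolderConjugate (q.conjExponent) := Real.HolderConjugate.conjExponent hq
  have h1 := ENNReal.lintegral_mul_le_Lp_mul_Lq (volume.restrict B) hpq
    hf.aemeasurable (g := fun _ => 1) aemeasurable_const
  simp only [Pi.mul_apply, mul_one, ENNReal.one_rpow, lintegral_const, one_mul,
    Measure.restrict_apply MeasurableSet.univ, univ_inter] at h1
  have h2 : 1 / q.conjExponent = -(1 / q) + 1 := by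
    have := hpq.inv_add_inv_eq_one
    rw [one_div, one_div]
    linarith
  rw [setLAverage_eq, ENNReal.div_le_iff hB0 hBt]
  calc ∫⁻ y in B, f y ≤ (∫⁻ y in B, f y ^ q) ^ (1 / q) * volume B ^ (1 / q.conjExponent) := h1
    _ ≤ (∫⁻ y, f y ^ q) ^ (1 / q) * volume B ^ (1 / q.conjExponent) := by
        gcongr
        exact Measure.restrict_le_self
    _ = _ := by
        rw [h2, ENNReal.rpow_add _ _ hB0 hBt, ENNReal.rpow_one]
        ring

/-- The Hardy–Littlewood–Sobolev inequality for the dyadic Riesz potential of order one. -/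
theorem exists_lintegral_tsum_laverage_rpow_le [NeZero d] {q : ℝ} (hq : 1 < q) (hqd : q < d) :
    ∃ C : ℝ≥0∞, C ≠ ⊤ ∧ ∀ (f : EuclideanSpace ℝ (Fin d) → ℝ≥0∞), AEMeasurable f →
      ∀ R : ℝ, 0 < R →
      ∫⁻ x, (∑' k : ℕ, ENNReal.ofReal (R / 2 ^ k) *
        ⨍⁻ y in Metric.closedBall x (3 * (R / 2 ^ k)), f y ∂volume) ^ (d * q / (d - q))
      ≤ C * ((∫⁻ y, f y ^ q) ^ (1 / q)) ^ (d * q / (d - q)) := by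
  have hd0 : (0 : ℝ) < d := by linarith
  have hq0 : 0 < q := by linarith
  have hdq : 0 < d - q := by linarith
  set p := d * q / (d - q) with hp
  have hp0 : 0 < p := by positivity
  -- Hölder bounds an average by a multiple of r^(-d/q); with the prefactor r this is r^(-β).
  set β := d / q - 1 with hβdef
  have hβ : 0 < β := by
    rw [hβdef, sub_pos, lt_div_iff₀ hq0]; linarith
  -- The Sobolev exponent p is exactly the one for which the maximal function enters to the power q;
  -- `e2` records that the total degree is then p.
  have e1 : β / (1 + β) * p = q := by
    have : (1 + β) = d / q := by rw [hβdef]; ring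
    rw [this, hβdef, hp]
    field_simp
  have e2 : q + 1 / (1 + β) * p = p := by
    have : (1 + β) = d / q := by rw [hβdef]; ring
    rw [this, hp]
    field_simp
    ring
  obtain ⟨C₁, hC₁, hedberg⟩ := exists_tsum_le_rpow_mul_rpow hβ
  set κ := volume.real (Metric.ball (0 : EuclideanSpace ℝ (Fin d)) 1) with hκ_def
  have hκ : 0 < κ :=
    ENNReal.toReal_pos (Metric.measure_ball_pos _ _ one_pos).ne' measure_ball_lt_top.ne
  set L := ENNReal.ofReal ((3 ^ d * κ) ^ (-(1 / q))) with hL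
  set C₂ : ℝ≥0∞ := ENNReal.ofReal q * (2 * 4 ^ Module.finrank ℝ (EuclideanSpace ℝ (Fin d))) *
    (2 ^ (q - 1) / ENNReal.ofReal (q - 1)) with hC₂
  have hC₂t : C₂ ≠ ⊤ := by
    have h1 : ENNReal.ofReal (q - 1) ≠ 0 := by simp; linarith
    have h2 : (2 : ℝ≥0∞) ^ (q - 1) / ENNReal.ofReal (q - 1) ≠ ⊤ :=
      ENNReal.div_ne_top (ENNReal.rpow_ne_top_of_nonneg (by linarith) (by simp)) h1
    rw [hC₂]
    finiteness
  refine ⟨C₁ ^ p * L ^ (1 / (1 + β) * p) * C₂, ?_, ?_⟩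
  · have h1 := ENNReal.rpow_ne_top_of_nonneg hp0.le hC₁
    have h2 : L ^ (1 / (1 + β) * p) ≠ ⊤ :=
      ENNReal.rpow_ne_top_of_nonneg (by positivity) ENNReal.ofReal_ne_top
    exact ENNReal.mul_ne_top (ENNReal.mul_ne_top h1 h2) hC₂t
  have main : ∀ (f : EuclideanSpace ℝ (Fin d) → ℝ≥0∞), Measurable f → ∀ R : ℝ, 0 < R →
      ∫⁻ x, (∑' k : ℕ, ENNReal.ofReal (R / 2 ^ k) *
        ⨍⁻ y in Metric.closedBall x (3 * (R / 2 ^ k)), f y ∂volume) ^ p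
      ≤ C₁ ^ p * L ^ (1 / (1 + β) * p) * C₂ * ((∫⁻ y, f y ^ q) ^ (1 / q)) ^ p := by
    intro f hf R hR
    set A := (∫⁻ y, f y ^ q) ^ (1 / q) with hA
    have hAq : ∫⁻ y, f y ^ q = A ^ q := by
      rw [hA, ← ENNReal.rpow_mul, one_div_mul_cancel hq0.ne', ENNReal.rpow_one]
    set m := maximalFunction (volume : Measure (EuclideanSpace ℝ (Fin d)))
      (fun k : ℕ => 3 * (R / 2 ^ k)) f with hm
    have hmm : Measurable m := measurable_maximalFunction _ _ hf
    have hr : ∀ k : ℕ, 0 < 3 * (R / 2 ^ k) := fun k => by positivity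
    have hrP : ∀ k : ℕ, 3 * (R / 2 ^ k) ≤ 3 * R := fun k => by
      gcongr
      exact div_le_self hR.le (one_le_pow₀ (by norm_num))
    have hpt : ∀ x, ∑' k : ℕ, ENNReal.ofReal (R / 2 ^ k) *
        ⨍⁻ y in Metric.closedBall x (3 * (R / 2 ^ k)), f y ∂volume
        ≤ C₁ * (m x ^ (β / (1 + β)) * (L * A) ^ (1 / (1 + β))) := by
      intro x
      refine hedberg R hR _ _ _ (fun k => ?_) (fun k => ?_)
      · gcongr
        exact le_iSup (fun k : ℕ => ⨍⁻ y in Metric.closedBall x (3 * (R / 2 ^ k)), f y ∂volume) k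
      · set r := R / 2 ^ k
        have hr0 : 0 < r := by positivity
        have hvol : volume (Metric.closedBall x (3 * r)) = ENNReal.ofReal ((3 * r) ^ d * κ) := by
          rw [hκ_def, ← volume_real_closedBall x (hr k),
            ofReal_measureReal measure_closedBall_lt_top.ne]
        refine (mul_le_mul_right (setLAverage_closedBall_le hq hf x (hr k)) _).trans
          (le_of_eq ?_)
        rw [hvol, ENNReal.ofReal_rpow_of_pos (by positivity), ← mul_assoc, ← mul_assoc,
          ← ENNReal.ofReal_mul hr0.le, hL, ← ENNReal.ofReal_mul (by positivity)]
        congr 2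
        have h3 : ((3 * r) ^ d * κ) = r ^ (d : ℝ) * (3 ^ d * κ) := by
          rw [Real.rpow_natCast, mul_pow]; ring
        rw [h3, Real.mul_rpow (by positivity) (by positivity), ← Real.rpow_mul hr0.le, ← mul_assoc]
        congr 1
        nth_rw 1 [← Real.rpow_one r]
        rw [← Real.rpow_add hr0]
        congr 1
        rw [hβdef]
        ring
    calc ∫⁻ x, (∑' k : ℕ, ENNReal.ofReal (R / 2 ^ k) *
          ⨍⁻ y in Metric.closedBall x (3 * (R / 2 ^ k)), f y ∂volume) ^ p
        ≤ ∫⁻ x, (C₁ * (m x ^ (β / (1 + β)) * (L * A) ^ (1 / (1 + β)))) ^ p := by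
          refine lintegral_mono fun x => ?_
          exact ENNReal.rpow_le_rpow (hpt x) hp0.le
      _ = ∫⁻ x, (C₁ ^ p * (L ^ (1 / (1 + β) * p) * A ^ (1 / (1 + β) * p))) * m x ^ q := by
          refine lintegral_congr fun x => ?_
          rw [ENNReal.mul_rpow_of_nonneg _ _ hp0.le, ENNReal.mul_rpow_of_nonneg _ _ hp0.le,
            ← ENNReal.rpow_mul, ← ENNReal.rpow_mul, e1,
            ENNReal.mul_rpow_of_nonneg _ _ (by positivity)]
          ring
      _ = (C₁ ^ p * (L ^ (1 / (1 + β) * p) * A ^ (1 / (1 + β) * p))) * ∫⁻ x, m x ^ q :=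
          lintegral_const_mul _ (hmm.pow_const q)
      _ ≤ (C₁ ^ p * (L ^ (1 / (1 + β) * p) * A ^ (1 / (1 + β) * p))) * (C₂ * A ^ q) := by
          rw [← hAq]
          gcongr
          exact lintegral_maximalFunction_rpow_le volume hq hr hrP hf
      _ = C₁ ^ p * L ^ (1 / (1 + β) * p) * C₂ * (A ^ q * A ^ (1 / (1 + β) * p)) := by ring
      _ = _ := by
          rw [← ENNReal.rpow_add_of_nonneg _ _ hq0.le (by positivity), e2]
  -- Averages and integrals ignore null sets, so the measurable case applied to a measurable
  -- representative suffices.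
  intro f hf R hR
  have h1 : ∀ x r, ⨍⁻ y in Metric.closedBall x r, f y ∂volume
      = ⨍⁻ y in Metric.closedBall x r, hf.mk f y ∂volume := by
    intro x r
    rw [setLAverage_eq, setLAverage_eq, lintegral_congr_ae (ae_restrict_of_ae hf.ae_eq_mk)]
  have h2 : ∫⁻ y, f y ^ q = ∫⁻ y, hf.mk f y ^ q :=
    lintegral_congr_ae (hf.ae_eq_mk.fun_comp (· ^ q))
  simp_rw [h1, h2]
  exact main _ hf.measurable_mk R hR

end Potential

/-! ### Passing to the mean value, and conclusion -/

/-- Up to a factor two, the mean value is the best constant in `L^p`. -/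
theorem eLpNorm_sub_average_le {α : Type*} [MeasurableSpace α] {ν : Measure α}
    [IsFiniteMeasure ν] {p : ENNReal} (hp : 1 ≤ p) {u : α → ℝ}
    (hu : Integrable u ν) (c : ℝ) :
    eLpNorm (fun x => u x - ⨍ y, u y ∂ν) p ν ≤ 2 * eLpNorm (fun x => u x - c) p ν := by
  rcases eq_or_ne ν 0 with rfl | hν
  · simp
  have : NeZero ν := ⟨hν⟩
  have hν0 : ν univ ≠ 0 := by simpa using hν
  have hνt : ν univ ≠ ⊤ := measure_ne_top _ _
  have hp0 : p ≠ 0 := (zero_lt_one.trans_le hp).ne'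
  have huc : Integrable (fun x => u x - c) ν := hu.sub (integrable_const c)
  set a := ⨍ y, u y ∂ν
  have h1 : a - c = ⨍ y, (u y - c) ∂ν := by
    have hν' : ν.real univ ≠ 0 := (ENNReal.toReal_pos hν0 hνt).ne'
    simp only [a, average_eq, smul_eq_mul]
    rw [integral_sub hu (integrable_const c), integral_const, smul_eq_mul]
    field_simp
  -- |a - c| is controlled by the L¹ norm of u - c; Hölder on the finite measure then yields the Lᵖ
  -- norm of the constant a - c.
  have h2 : ‖a - c‖ₑ * ν univ ≤ eLpNorm (fun x => u x - c) 1 ν := by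
    rw [eLpNorm_one_eq_lintegral_enorm, h1, average_eq, enorm_smul]
    have h3 : ‖(ν.real univ)⁻¹‖ₑ = (ν univ)⁻¹ := by
      have h3' : ν.real univ ≠ 0 := (ENNReal.toReal_pos hν0 hνt).ne'
      rw [enorm_inv h3', Real.enorm_of_nonneg measureReal_nonneg,
        ofReal_measureReal hνt]
    rw [h3, mul_right_comm, ENNReal.inv_mul_cancel hν0 hνt, one_mul]
    exact enorm_integral_le_lintegral_enorm _
  have h4 : eLpNorm (fun _ : α => a - c) p ν ≤ eLpNorm (fun x => u x - c) p ν := by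
    rw [eLpNorm_const _ hp0 hν]
    have h5 := h2.trans (eLpNorm_le_eLpNorm_mul_rpow_measure_univ hp huc.aestronglyMeasurable)
    rw [ENNReal.toReal_one, div_one, sub_eq_add_neg 1, ENNReal.rpow_add _ _ hν0 hνt,
      ENNReal.rpow_one] at h5
    have h6 : ν univ ^ (1 / p.toReal) * ν univ ^ (-(1 / p.toReal)) = 1 := by
      rw [← ENNReal.rpow_add _ _ hν0 hνt, add_neg_cancel, ENNReal.rpow_zero]
    calc ‖a - c‖ₑ * ν univ ^ (1 / p.toReal)
        = ‖a - c‖ₑ * ν univ * (ν univ)⁻¹ * ν univ ^ (1 / p.toReal) := by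
          rw [mul_assoc ‖a - c‖ₑ, ENNReal.mul_inv_cancel hν0 hνt, mul_one]
      _ ≤ eLpNorm (fun x => u x - c) p ν * (ν univ * ν univ ^ (-(1 / p.toReal))) *
          (ν univ)⁻¹ * ν univ ^ (1 / p.toReal) := by gcongr
      _ = eLpNorm (fun x => u x - c) p ν * (ν univ * (ν univ)⁻¹) *
          (ν univ ^ (1 / p.toReal) * ν univ ^ (-(1 / p.toReal))) := by ring
      _ = _ := by rw [h6, ENNReal.mul_inv_cancel hν0 hνt, mul_one, mul_one]
  have h7 : (fun x => u x - a) = (fun x => u x - c) - fun _ => a - c := by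
    ext x
    simp
  rw [h7, two_mul]
  exact (eLpNorm_sub_le huc.aestronglyMeasurable aestronglyMeasurable_const hp).trans
    (by gcongr)

end Reifenberg

/-- Local Poincaré inequality at the boundary of a Reifenberg flat domain. -/
theorem theorem3p4 (d : ℕ) [NeZero d] (hd : 2 ≤ d) (q : ℝ) (hq : 1 < q) (hqd : q < d) :
    ∃ N : ℝ, 0 < N ∧
      ∀ (γ R₀ : ℝ) (Ω : Set (EuclideanSpace ℝ (Fin d))),
        0 ≤ γ → γ ≤ 1 / 48 → 0 < R₀ →
        IsOpen Ω → IsConnected Ω → Reifenberg.IsReifenbergFlat γ R₀ Ω →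
        ∀ x₀ ∈ frontier Ω, ∀ R : ℝ, 0 < R → R ≤ R₀ / 4 →
        ∀ (u : EuclideanSpace ℝ (Fin d) → ℝ)
          (Du : EuclideanSpace ℝ (Fin d) → EuclideanSpace ℝ (Fin d)),
          Reifenberg.MemW1 Ω q u Du →
          eLpNorm (fun x => u x - ⨍ y in Ω ∩ Metric.ball x₀ R, u y)
              (ENNReal.ofReal (d * q / (d - q))) (volume.restrict (Ω ∩ Metric.ball x₀ R))
            ≤ ENNReal.ofReal N *
              eLpNorm Du (ENNReal.ofReal q) (volume.restrict (Ω ∩ Metric.ball x₀ (2 * R))) := by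
  obtain ⟨A, hA, hosc⟩ := Reifenberg.exists_edist_le_tsum_laverage d
  obtain ⟨C, hC, hHLS⟩ := Reifenberg.exists_lintegral_tsum_laverage_rpow_le hq hqd
  have hq0 : 0 < q := by linarith
  have hdq : 0 < d - q := by linarith
  have hd0 : (0 : ℝ) < d := by linarith
  have hp1 : 1 ≤ d * q / (d - q) := by
    rw [le_div_iff₀ hdq]; nlinarith
  set p := d * q / (d - q)
  have hp0 : 0 < p := by linarith
  -- The added 1 only secures positivity, as C may vanish.
  refine ⟨2 * A * (C ^ (1 / p)).toReal + 1, by positivity, ?_⟩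
  intro γ R₀ Ω _ hγ hR₀ hΩ _ hflat x₀ hx₀ R hR hRR₀ u Du hu
  set W := Ω ∩ Metric.ball x₀ (2 * R)
  set S := Ω ∩ Metric.ball x₀ R
  have hWm : MeasurableSet W := (hΩ.inter Metric.isOpen_ball).measurableSet
  have hSm : MeasurableSet S := (hΩ.inter Metric.isOpen_ball).measurableSet
  have hSW : S ⊆ W := inter_subset_inter_right _ (Metric.ball_subset_ball (by linarith))
  have : IsFiniteMeasure (volume.restrict W) :=
    isFiniteMeasure_restrict.mpr (measure_ne_top_of_subset inter_subset_right measure_ball_lt_top.ne)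
  have : IsFiniteMeasure (volume.restrict S) :=
    isFiniteMeasure_restrict.mpr (measure_ne_top_of_subset inter_subset_right measure_ball_lt_top.ne)
  have hq1 : 1 ≤ ENNReal.ofReal q := by simpa using hq.le
  have hWΩ : volume.restrict W ≤ volume.restrict Ω := Measure.restrict_mono inter_subset_left le_rfl
  have huW : IntegrableOn u W := (hu.memLp.mono_measure hWΩ).integrable hq1
  have hDuW : IntegrableOn Du W := (hu.memLp_grad.mono_measure hWΩ).integrable hq1
  obtain ⟨c, hc⟩ := hosc hΩ (fun p hp s hs hsR => hflat.exists_flatAt hγ hp hs hsR) hx₀ hR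
    (by linarith) huW hDuW (fun i => (hu.hasWeakPartialDeriv i).mono inter_subset_left)
  set f : EuclideanSpace ℝ (Fin d) → ENNReal := W.indicator (fun y => ‖Du y‖ₑ)
  have hf : AEMeasurable f :=
    (aemeasurable_indicator_iff hWm).mpr hDuW.aestronglyMeasurable.enorm
  have hfq : (∫⁻ y, f y ^ q) ^ (1 / q) = eLpNorm Du (ENNReal.ofReal q) (volume.restrict W) := by
    rw [eLpNorm_eq_lintegral_rpow_enorm_toReal (by simpa using hq0) ENNReal.ofReal_ne_top,
      ENNReal.toReal_ofReal hq0.le, ← lintegral_indicator hWm]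
    congr 2
    ext y
    by_cases hy : y ∈ W <;> simp [f, hy, hq0]
  have hmain : eLpNorm (fun x => u x - c) (ENNReal.ofReal p) (volume.restrict S)
      ≤ ENNReal.ofReal A * C ^ (1 / p) *
        eLpNorm Du (ENNReal.ofReal q) (volume.restrict W) := by
    rw [eLpNorm_eq_lintegral_rpow_enorm_toReal (by simpa using hp0) ENNReal.ofReal_ne_top,
      ENNReal.toReal_ofReal hp0.le, ← hfq]
    set X := (∫⁻ y, f y ^ q) ^ (1 / q)
    have h1 : ∫⁻ x in S, ‖u x - c‖ₑ ^ p ≤ ENNReal.ofReal A ^ p * (C * X ^ p) := by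
      calc ∫⁻ x in S, ‖u x - c‖ₑ ^ p
          ≤ ∫⁻ x in S, (ENNReal.ofReal A * ∑' k : ℕ, ENNReal.ofReal (R / 2 ^ k) *
              ⨍⁻ y in Metric.closedBall x (3 * (R / 2 ^ k)), f y ∂volume) ^ p := by
            refine setLIntegral_mono_ae' hSm ?_
            filter_upwards [hc] with x hx hxS
            refine ENNReal.rpow_le_rpow ?_ hp0.le
            rw [← ENNReal.tsum_mul_left, ← edist_eq_enorm_sub, edist_comm]
            exact hx hxS
        _ ≤ ∫⁻ x, (ENNReal.ofReal A * ∑' k : ℕ, ENNReal.ofReal (R / 2 ^ k) *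
              ⨍⁻ y in Metric.closedBall x (3 * (R / 2 ^ k)), f y ∂volume) ^ p :=
            lintegral_mono' Measure.restrict_le_self le_rfl
        _ = ENNReal.ofReal A ^ p * ∫⁻ x, (∑' k : ℕ, ENNReal.ofReal (R / 2 ^ k) *
              ⨍⁻ y in Metric.closedBall x (3 * (R / 2 ^ k)), f y ∂volume) ^ p := by
            simp_rw [ENNReal.mul_rpow_of_nonneg _ _ hp0.le]
            exact lintegral_const_mul' _ _
              (ENNReal.rpow_ne_top_of_nonneg hp0.le ENNReal.ofReal_ne_top)
        _ ≤ _ := by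
            gcongr
            exact hHLS f hf R hR
    calc (∫⁻ x in S, ‖u x - c‖ₑ ^ p) ^ (1 / p)
        ≤ (ENNReal.ofReal A ^ p * (C * X ^ p)) ^ (1 / p) :=
          ENNReal.rpow_le_rpow h1 (by positivity)
      _ = _ := by
        have hpp : p * (1 / p) = 1 := by field_simp
        rw [ENNReal.mul_rpow_of_nonneg _ _ (by positivity),
          ENNReal.mul_rpow_of_nonneg _ _ (by positivity), ← ENNReal.rpow_mul, ← ENNReal.rpow_mul,
          hpp, ENNReal.rpow_one, ENNReal.rpow_one, mul_assoc]
  have hCp : C ^ (1 / p) ≠ ⊤ := ENNReal.rpow_ne_top_of_nonneg (by positivity) hC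
  calc eLpNorm (fun x => u x - ⨍ y in S, u y) (ENNReal.ofReal p) (volume.restrict S)
      ≤ 2 * eLpNorm (fun x => u x - c) (ENNReal.ofReal p) (volume.restrict S) :=
        Reifenberg.eLpNorm_sub_average_le (by simpa using hp1) (huW.mono_set hSW) c
    _ ≤ 2 * (ENNReal.ofReal A * C ^ (1 / p) *
        eLpNorm Du (ENNReal.ofReal q) (volume.restrict W)) := by gcongr
    _ = ENNReal.ofReal (2 * A * (C ^ (1 / p)).toReal) *
        eLpNorm Du (ENNReal.ofReal q) (volume.restrict W) := by
        rw [ENNReal.ofReal_mul (by positivity), ENNReal.ofReal_mul (by norm_num),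
          ENNReal.ofReal_toReal hCp, ENNReal.ofReal_ofNat]
        ring
    _ ≤ _ := by
        gcongr
        linarith
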